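/- **Theorem (B-Way Join Analysis).** Let $B\ge 2$. A *B-tree* over a linearly ordered set of keys is either an external node (of height $0$) or a node with keys $\kappa_1<\dots<\kappa_d$ and $d+1$ subtrees of equal height such that all keys in the $i$-th subtree are less than $\kappa_i$ and all keys in the $(i+1)$-st are greater than $\kappa_i$; its height is one more than that of its subtrees. The root (if it is not external) has between $1$ and $B$ keys, and every other non-external node has between $\lfloor B/2\rfloor$ and $B$ keys. *Cost model.* A fork-join program works on an external memory made of blocks of $O(B)$ words. Reading or writing one block costs one unit and computation inside a thread is free. A fork creates $O(B)$ threads, which return $O(B)$ words in total when they are synchronized. (A fork of $n$ threads is also charged one unit of span and $n$ units of work.) The *I/O work* is the total cost, and the *I/O span* is the largest cost along a path of dependent operations. Each node of a B-tree is stored in one block, and a tree is given by a pointer to its root together with its height. *Algorithm.* Let $0\le b\le B$, let $T_1,\dots,T_{b+1}$ be B-trees and let $k_1<\dots<k_b$ be keys such that every key of $T_i$ is less than $k_i$ and every key of $T_{i+1}$ is greater than $k_i$, for $1\le i\le b$. B-Way-Join is the following recursive algorithm. If $b=0$, return $T_1$. Otherwise let $h^*$ be the largest height of the $T_i$, and call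 a tree *tall* if its height is $h^*$. If $h^*=0$, create one node with keys $k_1,\dots,k_b$. If $h^*>0$, do the following in parallel: for each tall tree, recursively join its rightmost subtree with the (non-tall) trees between it and the next tall tree, or the end, using the keys in front of these trees, and let the result replace that subtree; and if $T_1$ is not tall, recursively join all trees before the first tall tree with the leftmost subtree of that tree, using all keys before it, and let the result replace that subtree. Then concatenate the roots of the resulting tall trees into one node, separated by the keys $k_{i-1}$ in front of each tall tree $T_i$ other than the first; move the root keys of every child of this node that has height $h^*$ (instead of $h^*-1$) up into the node; and if the node now has more than $B$ keys, divide it evenly into the least possible number of nodes with at most $B$ keys, and promote the keys between them to a new root. Let $h_{\max}$ and $h_{\min}$ be the largest and smallest height of $T_1,\dots,T_{b+1}$. Then B-Way-Join returns a valid B-tree whose set of keys is $\{k_1,\dots,k_b\}\cup\bigcup_i T_i$, and it runs in $$O(h_{\max}-h_{\min}+1)\ \text{I/O span}\quad\text{and}\quad O\bigl(b\,(h_{\max}-h_{\min}+1)\bigr)\ \text{I/O work}.$$ All implied constants (including those in the cost model) are absolute: they do not depend on $B$, $b$, the trees or the keys. -/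

import Mathlib

namespace BWay

universe u

/-! ### B-trees -/

/-- Multi-way search trees: an external node, or a node with `b` keys and `b + 1` subtrees. -/
inductive BTree (K : Type u) : Type u
  | ext : BTree K
  | node (b : ℕ) (key : Fin b → K) (child : Fin (b + 1) → BTree K) : BTree K

namespace BTree

variable {K : Type u}

/-- The set of keys stored in a tree. -/
def keys : BTree K → Set K
  | ext => ∅
  | node _ key child => Set.range key ∪ ⋃ i, (child i).keys

/-- External nodes have height `0`; a node is one higher than its (first) child. -/
def height : BTree K → ℕ
  | ext => 0
  | node _ _ child => (child 0).height + 1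

/-- `SearchOrder k C`: the keys `k` are increasing and separate the key sets `C`, consecutive
sets `C i`, `C (i+1)` lying strictly below and strictly above `k i`. -/
def SearchOrder [LinearOrder K] {b : ℕ} (k : Fin b → K) (C : Fin (b + 1) → Set K) : Prop :=
  StrictMono k ∧ ∀ i : Fin b, (∀ x ∈ C i.castSucc, x < k i) ∧ (∀ y ∈ C i.succ, k i < y)

/-- `t.WithRoot B lo`: every node of `t` has at most `B` keys, every node other than the root has
at least `⌊B/2⌋` keys, the root (if `t` is not external) has at least `lo` keys, the keys are in
search order, and siblings have equal heights (so all external nodes have the same depth). -/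
def WithRoot [LinearOrder K] (B : ℕ) : BTree K → ℕ → Prop
  | ext, _ => True
  | node b key child, lo =>
      lo ≤ b ∧ b ≤ B ∧
      SearchOrder key (fun i => (child i).keys) ∧
      (∀ i, (child i).height = (child 0).height) ∧
      ∀ i, (child i).WithRoot B (B / 2)

/-- Valid B-trees: the root has between `1` and `B` keys (at least two subtrees), all other nodes
between `⌊B/2⌋` and `B` keys. -/
def IsBTree [LinearOrder K] (B : ℕ) (t : BTree K) : Prop := t.WithRoot B 1

end BTree

/-! ### The fork-join model with block transfers

External memory is a list of blocks, each a sequence of machine words. Programs access it only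
through the instructions `read` and `alloc`, each of which transfers one block. -/

/-- A machine word: a key, a pointer (`none` is the null pointer), or a number. -/
inductive Word (K : Type u) : Type u
  | key (k : K) : Word K
  | ptr (p : Option ℕ) : Word K
  | num (n : ℕ) : Word K

/-- External memory. The address of a block is its index. -/
abbrev Store (K : Type u) : Type u := List (List (Word K))

/-- Fork-join programs (computation inside a thread is free and is written as a function).
* `ret ws`: the thread ends and hands the words `ws` to the thread that forked it.
* `read a k`: transfer the block at address `a` to the thread, go on with `k`.
* `alloc ws k`: transfer the words `ws` to a new block, go on with `k` at its address.
* `fork n t k`: run the `n` threads `t i` in parallel; when all of them have ended, go on with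
  `k` at the list of the words they returned. -/
inductive Prog (K : Type u) : Type u
  | ret (ws : List (Word K)) : Prog K
  | read (a : ℕ) (k : List (Word K) → Prog K) : Prog K
  | alloc (ws : List (Word K)) (k : ℕ → Prog K) : Prog K
  | fork (n : ℕ) (t : Fin n → Prog K) (k : List (List (Word K)) → Prog K) : Prog K

/-- The result of an execution: returned value, memory, and costs. `work` is the total number of
block transfers, `span` the maximum number on a path of dependent ones, both including a charge
for forks. `width` is the largest number of words that any single instruction moved between
memory and a thread or between threads at a synchronization, and of threads that any single
fork created. It has to be `O(B)`: a block holds `O(B)` words, and a fork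
creates `O(B)` threads that return `O(B)` words in total. All that a thread can hold was brought
in on its path from the start, so a bound `s` on the span also bounds its local memory by
`O(s)` blocks. -/
structure Outcome (K : Type u) (α : Type u) : Type u where
  val : α
  store : Store K
  work : ℕ
  span : ℕ
  width : ℕ

/-- Combined outcome of the parallel threads `f i`: the works add up, the span is the maximum.
Since memory is never overwritten, the order in which the threads are listed only affects
the names of new addresses. -/
def runThreads {K : Type u} : (n : ℕ) → (Fin n → Store K → Outcome K (List (Word K))) →
    Store K → Outcome K (List (List (Word K)))
  | 0, _, σ => ⟨[], σ, 0, 0, 0⟩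
  | n + 1, f, σ =>
      let r := f 0 σ
      let s := runThreads n (fun i => f i.succ) r.store
      ⟨r.val :: s.val, s.store, r.work + s.work, max r.span s.span, max r.width s.width⟩

/-- Execution. Every block transfer costs one unit of work and of span. A fork of `n` threads is
charged one unit of span and `n` units of work on top of the costs of the threads. -/
def Prog.run {K : Type u} : Prog K → Store K → Outcome K (List (Word K))
  | .ret ws, σ => ⟨ws, σ, 0, 0, 0⟩
  | .read a k, σ =>
      let ws := σ.getD a []
      let r := (k ws).run σ
      ⟨r.val, r.store, 1 + r.work, 1 + r.span, max ws.length r.width⟩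
  | .alloc ws k, σ =>
      let r := (k σ.length).run (σ ++ [ws])
      ⟨r.val, r.store, 1 + r.work, 1 + r.span, max ws.length r.width⟩
  | .fork n t k, σ =>
      let s := runThreads n (fun i => (t i).run) σ
      let r := (k s.val).run s.store
      ⟨r.val, r.store, n + s.work + r.work, 1 + s.span + r.span,
        max (max n s.val.flatten.length) (max s.width r.width)⟩

/-! ### B-trees in external memory -/

/-- The block of a node: `c₀ k₁ c₁ k₂ c₂ …` (pointers to the children, and keys). -/
def nodeBlock {K : Type u} {b : ℕ} (key : Fin b → K) (c : Fin (b + 1) → Option ℕ) :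
    List (Word K) :=
  .ptr (c 0) :: (List.ofFn fun i : Fin b => [Word.key (key i), Word.ptr (c i.succ)]).flatten

/-- `t.Stored σ p`: in the memory `σ`, the pointer `p` refers to (the root of) the tree `t`.
Every node occupies one block; external nodes are null pointers. -/
def BTree.Stored {K : Type u} (σ : Store K) : BTree K → Option ℕ → Prop
  | .ext, p => p = none
  | .node b key child, p =>
      ∃ (a : ℕ) (c : Fin (b + 1) → Option ℕ), p = some a ∧ σ[a]? = some (nodeBlock key c) ∧
        ∀ i, (child i).Stored σ (c i)

/-- A tree is handed over as a pointer to its root, together with its height. -/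
structure Ref where
  root : Option ℕ
  height : ℕ

def Ref.words {K : Type u} (t : Ref) : List (Word K) := [.ptr t.root, .num t.height]

def Ref.ofWords {K : Type u} : List (Word K) → Ref
  | [.ptr p, .num h] => ⟨p, h⟩
  | _ => ⟨none, 0⟩

/-! ### The join algorithm -/

section Algorithm

variable {K : Type u}

/-- The pointer in a word. -/
def Word.toPtr : Option (Word K) → Option ℕ
  | some (.ptr p) => p
  | _ => none

/-- Parallel for-loop over a list. -/
def Prog.parFor {α : Type*} (l : List α) (f : α → Prog K) (k : List (List (Word K)) → Prog K) :
    Prog K :=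
  .fork l.length (fun i => f (l.get i)) k

/-- Read the block that a pointer refers to. -/
def Prog.readPtr (p : Option ℕ) (k : List (Word K) → Prog K) : Prog K :=
  match p with
  | some a => .read a k
  | none => k []

/-- A part of the contents of a node under construction: words held by the thread, or `len`
words of the block at address `a`, from position `start` on. -/
inductive Piece (K : Type u) : Type u
  | lit (ws : List (Word K)) : Piece K
  | slice (a start len : ℕ) : Piece K

def Piece.length : Piece K → ℕ
  | .lit ws => ws.length
  | .slice _ _ len => len

/-- The `n` words of a piece from position `i` on. -/
def Piece.cut (i n : ℕ) : Piece K → Piece K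
  | .lit ws => .lit ((ws.drop i).take n)
  | .slice a start len => .slice a (start + i) (min n (len - i))

/-- The `n` words from position `i` on of a concatenation of pieces. -/
def cutPieces : List (Piece K) → ℕ → ℕ → List (Piece K)
  | [], _, _ => []
  | p :: ps, i, n =>
      if n = 0 then []
      else if p.length ≤ i then cutPieces ps (i - p.length) n
      else p.cut i n :: cutPieces ps 0 (n - (p.length - i))

/-- Collect the words of a concatenation of pieces, with one thread per piece. -/
def gather (ps : List (Piece K)) (k : List (Word K) → Prog K) : Prog K :=
  .parFor ps
    (fun
      | .lit ws => .ret ws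
      | .slice a start len => .read a fun blk => .ret ((blk.drop start).take len))
    fun replies => k replies.flatten

/-- Given, as a concatenation of pieces, the contents `c₀ k₁ c₁ … kₙ cₙ` of a root at height `h`
that may have more than `B` keys: divide it evenly into the least number `q` of nodes with at
most `B` keys, separated by `q - 1` promoted keys, which become a new root at height `h + 1` if
`q > 1`. -/
def simpleRebalance (B h : ℕ) (ps : List (Piece K)) : Prog K :=
  let c := ((ps.map Piece.length).sum + 1) / 2
  let q := (c + B) / (B + 1)
  .fork q
    (fun j =>
      let s := j * c / q
      let d := (j + 1) * c / q - s
      gather (cutPieces ps (2 * s) (2 * d)) fun ws =>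
        .alloc (ws.take (2 * d - 1)) fun a => .ret (.ptr (some a) :: ws.drop (2 * d - 1)))
    fun replies =>
      let ws := replies.flatten
      if q = 1 then .ret (Ref.words ⟨Word.toPtr ws.head?, h⟩)
      else .alloc ws fun a => .ret (Ref.words ⟨some a, h + 1⟩)

/-- A summand of the concatenated root: words held by the thread, or the block that a pointer
refers to, without its first and / or last word. -/
inductive Source (K : Type u) : Type u
  | lit (ws : List (Word K)) : Source K
  | block (p : Option ℕ) (dropFirst dropLast : Bool) : Source K

/-- Measure the sources (in parallel), then rebalance their concatenation. -/
def concatenate (B h : ℕ) (ss : List (Source K)) : Prog K :=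
  .parFor ss
    (fun
      | .lit ws => .ret [.num ws.length]
      | .block p _ _ => .readPtr p fun blk => .ret [.num blk.length])
    fun replies =>
      simpleRebalance B h <| List.zipWith
        (fun s reply =>
          match s, reply with
          | .lit ws, _ => .lit ws
          | .block (some a) l r, [.num n] => .slice a l.toNat (n - l.toNat - r.toNat)
          | _, _ => .lit [])
        ss replies

/-- How a subtree `X` enters a node at height `h`: by a pointer, if it has height `h - 1`;
if it has height `h`, the contents of its root are moved up into the node. -/
def subtreeSource (h : ℕ) (X : Ref) : Source K :=
  if X.height = h then .block X.root false false else .lit [.ptr X.root]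

/-- Split `k₁ T₁ k₂ T₂ …` before each tall tree (each tree of height `h`), into the part before
the first tall tree and, for each tall tree, the key before it, the tree, and the short trees
that follow up to the next tall tree, with the keys before them. -/
def splitTall (h : ℕ) : List (K × Ref) → List (K × Ref) × List (K × Ref × List (K × Ref))
  | [] => ([], [])
  | (k, t) :: xs =>
      let (s, gs) := splitTall h xs
      if t.height = h then ([], (k, t, s) :: gs) else ((k, t) :: s, gs)

/-- The partition of the input: `lead` consists of the trees before the first tall tree (if
any), the keys between them, and the key before the first tall tree; `first` is the first tall
tree and `short` the short trees that follow it; `rest` are the other tall trees, each with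
the key before it and the short trees that follow. -/
structure Grouping (K : Type u) where
  lead : Option (Ref × List (K × Ref) × K)
  first : Ref
  short : List (K × Ref)
  rest : List (K × Ref × List (K × Ref))

def grouping (h : ℕ) (t₀ : Ref) (xs : List (K × Ref)) : Grouping K :=
  match splitTall h xs with
  | (s, gs) =>
    if t₀.height = h then ⟨none, t₀, s, gs⟩
    else
      match gs with
      | (k, t, s') :: gs' => ⟨some (t₀, s, k), t, s', gs'⟩
      | [] => ⟨none, t₀, s, []⟩

/-- Join `T₀ k₁ T₁ k₂ T₂ …`, where `h` is the height of the tallest tree and the list holds the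
pairs `(kᵢ, Tᵢ)`. The short trees after a tall tree are joined recursively to its rightmost
subtree; those before the first tall tree are joined recursively to its leftmost subtree; the
resulting tall trees and the remaining keys are concatenated and rebalanced. -/
def joinAt (B : ℕ) : ℕ → Ref → List (K × Ref) → Prog K
  | _, t₀, [] => .ret t₀.words
  | 0, t₀, x :: xs =>
      .alloc (.ptr t₀.root :: ((x :: xs).map fun y => [.key y.1, .ptr y.2.root]).flatten)
        fun a => .ret (Ref.words ⟨some a, 1⟩)
  | h + 1, t₀, x :: xs =>
      let G := grouping (h + 1) t₀ (x :: xs)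
      let trailing := (G.first, G.short) :: G.rest.map Prod.snd
      let trailingCalls := trailing.map fun g =>
        .readPtr g.1.root fun blk => joinAt B h ⟨Word.toPtr blk.getLast?, h⟩ g.2
      match G.lead with
      | none =>
        .parFor trailingCalls id fun replies =>
          let Xs := replies.map Ref.ofWords
          concatenate B (h + 1) <|
            [.block G.first.root false true, subtreeSource (h + 1) (Xs.headD ⟨none, 0⟩)] ++
            (List.zipWith (fun g X =>
                [.lit [.key g.1], .block g.2.1.root false true, subtreeSource (h + 1) X])
              G.rest Xs.tail).flatten
      | some (u, s, k) =>
        let leadingCall := .readPtr G.first.root fun blk =>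
          joinAt B h u (s ++ [(k, ⟨Word.toPtr blk.head?, h⟩)])
        .parFor (leadingCall :: trailingCalls) id fun replies =>
          let Y := Ref.ofWords (replies.headD [])
          let Xs := replies.tail.map Ref.ofWords
          concatenate B (h + 1) <|
            [subtreeSource (h + 1) Y, .block G.first.root true true,
              subtreeSource (h + 1) (Xs.headD ⟨none, 0⟩)] ++
            (List.zipWith (fun g X =>
                [.lit [.key g.1], .block g.2.1.root false true, subtreeSource (h + 1) X])
              G.rest Xs.tail).flatten

/-- The B-way join of the trees `T₀, …, T_b` with the separator keys `k₀, …, k_{b-1}`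
(`k i` between `T i` and `T (i+1)`). -/
def bWayJoin (B : ℕ) {b : ℕ} (T : Fin (b + 1) → Ref) (k : Fin b → K) : Prog K :=
  joinAt B (Finset.univ.sup fun i => (T i).height) (T 0)
    (List.ofFn fun i : Fin b => (k i, T i.succ))

end Algorithm

end BWay

namespace BWay

universe u

variable {K : Type u}

/-! ### In-order key lists -/

namespace BTree

/-! Order and shape are separated. A tree is valid exactly if its sizes and heights are right
(`Shape`) and its in-order key list is strictly increasing (`withRoot_iff`). Joining never permutes
keys: the in-order list of the result is that of the trees and separators read from left to right.
So it suffices to follow lists and shapes; search order and key set of the result are read off once,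
at the end, from the sortedness of the input list.

Memory only grows, so whatever holds of a stored tree survives later allocations (the `mono`
lemmas). Programs are treated by a Hoare-style logic (`Prog.Sat`, `ParSat`) that bounds work, span
and width along with correctness. A node becomes an alternating sequence of pointers and keys
(`Entries`, `treeAt_succ`), which can be cut and concatenated freely.

The heart is the invariant `JoinResult`: a join at height `h` with `n` separators yields either a
tree of height `h`, whose root has at least as many keys as the tall roots are known to have
together, or one of height `h + 1` whose root has at most `n` keys. Why it persists: let there be `g
+ 1` tall trees. Each separator either precedes one of the last `g` of them or goes to exactly one
recursive call; let `n` be the number of the latter. A call that grew adds at most as many keys as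
it has separators, so the concatenated root has at most `(g + 1)(B + 1) + n` pointers. It fits into
`g + n + 1` nodes, and at most `g + n` keys are promoted (`concatenated_length_lt`,
`simpleRebalance_sat`). If two or more nodes are needed, an even division leaves each at least `B /
2` keys. The lower bound makes a rejoined subtree that kept its height a legal non-root again.

Costs: with `c > 0` separators, one level takes `O(c)` work and `O(1)` span, and its recursive calls
share at most `c` separators. Below the minimal height no short trees are left and calls return at
once. Hence `O(1)` span and `O(c)` work on each of `h + 1 - m` levels (`joinSpec`). -/

/-- The keys of a tree in symmetric order. -/
def inorder : BTree K → List K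
  | ext => []
  | node _ key child =>
      (child 0).inorder ++ (List.ofFn fun i => key i :: (child i.succ).inorder).flatten

/-- The conditions of `WithRoot` on sizes and heights, with `hi` an upper bound for the number of
keys of the root. -/
def Shape (B : ℕ) : BTree K → ℕ → ℕ → Prop
  | ext, _, _ => True
  | node b _ child, lo, hi =>
      lo ≤ b ∧ b ≤ hi ∧ (∀ i, (child i).height = (child 0).height) ∧
      ∀ i, (child i).Shape B (B / 2) B

theorem mem_interleave {b : ℕ} (k : Fin b → K) (L : Fin (b + 1) → List K) (x : K) :
    x ∈ L 0 ++ (List.ofFn fun i => k i :: L i.succ).flatten ↔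
      x ∈ Set.range k ∪ ⋃ i, {y | y ∈ L i} := by
  simp only [List.mem_append, List.mem_flatten, List.mem_ofFn, Set.mem_union, Set.mem_range,
    Set.mem_iUnion, Set.mem_ofPred_eq, Fin.exists_fin_succ (P := fun i => x ∈ L i)]
  constructor
  · rintro (h | ⟨_, ⟨i, rfl⟩, h⟩)
    · exact Or.inr (Or.inl h)
    · rcases List.mem_cons.1 h with h | h
      · exact Or.inl ⟨i, h.symm⟩
      · exact Or.inr (Or.inr ⟨i, h⟩)
  · rintro (⟨i, h⟩ | h | ⟨i, h⟩)
    · exact Or.inr ⟨_, ⟨i, rfl⟩, by simp [h]⟩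
    · exact Or.inl h
    · exact Or.inr ⟨_, ⟨i, rfl⟩, by simp [h]⟩

theorem mem_inorder (t : BTree K) (x : K) : x ∈ t.inorder ↔ x ∈ t.keys := by
  induction t with
  | ext => simp [inorder, keys]
  | node b key child ih =>
    rw [inorder, keys, mem_interleave key fun i => (child i).inorder]
    simp [ih]

variable [LinearOrder K]

theorem SearchOrder.tail {b : ℕ} {k : Fin (b + 1) → K} {C : Fin (b + 2) → Set K}
    (h : SearchOrder k C) : SearchOrder (fun i => k i.succ) (fun i => C i.succ) :=
  ⟨fun _ _ hij => h.1 (Fin.succ_lt_succ_iff.2 hij), fun i => h.2 i.succ⟩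

/-- The local comparisons of a node amount to sortedness of one list. This is the only place where
order is argued about. -/
theorem pairwise_interleave_iff {b : ℕ} (k : Fin b → K) (L : Fin (b + 1) → List K) :
    (L 0 ++ (List.ofFn fun i => k i :: L i.succ).flatten).Pairwise (· < ·) ↔
      (∀ i, (L i).Pairwise (· < ·)) ∧ SearchOrder k (fun i => {x | x ∈ L i}) := by
  induction b with
  | zero =>
    simp only [List.ofFn_zero, List.flatten_nil, List.append_nil, SearchOrder]
    constructor
    · intro h
      exact ⟨Fin.cases h fun i => i.elim0, fun i => i.elim0, fun i => i.elim0⟩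
    · exact fun h => h.1 0
  | succ b ih =>
    have key := ih (fun i => k i.succ) (fun i => L i.succ)
    have mem := mem_interleave (fun i => k i.succ) (fun i => L i.succ)
    rw [List.ofFn_succ, List.flatten_cons, List.cons_append, List.pairwise_append,
      List.pairwise_cons, key]
    constructor
    · rintro ⟨h0, ⟨hk, hL, hS⟩, hlt⟩
      refine ⟨Fin.cases h0 hL, ?_, Fin.cases ⟨fun x hx => hlt x hx _ (by simp), fun y hy =>
        hk y ((mem y).2 (Or.inr (Set.mem_iUnion.2 ⟨0, hy⟩)))⟩ hS.2⟩
      refine Fin.cases (Fin.cases (fun h => absurd h (lt_irrefl _)) fun j _ => ?_)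
        fun i => Fin.cases (fun h => absurd h (Fin.not_lt_zero _)) fun j hij => ?_
      · exact hk _ ((mem _).2 (Or.inl ⟨j, rfl⟩))
      · exact hS.1 (Fin.succ_lt_succ_iff.1 hij)
    · rintro ⟨hL, hS⟩
      -- `SearchOrder` compares `k 0` only with the two neighbouring sets; elements of later sets
      -- are reached through the separator just before them.
      have hk : ∀ y ∈ L (Fin.succ 0) ++
          (List.ofFn fun i : Fin b => k i.succ :: L i.succ.succ).flatten, k 0 < y := by
        intro y hy
        rcases (mem y).1 hy with ⟨j, rfl⟩ | hy
        · exact hS.1 (Fin.succ_pos j)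
        · obtain ⟨j, hj⟩ := Set.mem_iUnion.1 hy
          exact (hS.1.monotone (Fin.zero_le j)).trans_lt ((hS.2 j).2 y hj)
      refine ⟨hL 0, ⟨hk, fun i => hL i.succ, hS.tail⟩, fun x hx y hy => ?_⟩
      have hx0 : x < k 0 := (hS.2 0).1 x hx
      rcases List.mem_cons.1 hy with rfl | hy
      · exact hx0
      · exact hx0.trans (hk y hy)

theorem withRoot_iff (B : ℕ) (t : BTree K) (lo : ℕ) :
    t.WithRoot B lo ↔ t.Shape B lo B ∧ t.inorder.Pairwise (· < ·) := by
  induction t generalizing lo with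
  | ext => simp [WithRoot, Shape, inorder]
  | node b key child ih =>
    have e : (fun i => (child i).keys) = fun i => {x | x ∈ (child i).inorder} := by
      funext i; ext x; exact (mem_inorder _ _).symm
    rw [WithRoot, Shape, inorder, pairwise_interleave_iff key fun i => (child i).inorder, e]
    simp only [ih, forall_and]
    tauto

end BTree

/-! ### Stored trees and sequences of entries -/

/-- In the memory `σ`, the pointer `p` refers to a tree of height `h` with in-order list `l` in
which the root has between `lo` and `hi` keys. -/
def TreeAt (σ : Store K) (B lo hi h : ℕ) (p : Option ℕ) (l : List K) : Prop :=
  ∃ t : BTree K, t.Stored σ p ∧ t.Shape B lo hi ∧ t.height = h ∧ t.inorder = l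

/-- The words `ws` are alternately pointers to non-root trees of height `h` and keys, with
in-order list `l`. A Boolean tells whether a pointer (or else a key) is expected; `s` belongs to
the beginning and `e` to the end of `ws`. -/
inductive Entries (σ : Store K) (B h : ℕ) : Bool → Bool → List (Word K) → List K → Prop
  | nil (s) : Entries σ B h s s [] []
  | key {e ws l} (k) : Entries σ B h true e ws l → Entries σ B h false e (.key k :: ws) (k :: l)
  | tree {e ws l p l'} : TreeAt σ B (B / 2) B h p l' → Entries σ B h false e ws l →
      Entries σ B h true e (.ptr p :: ws) (l' ++ l)

theorem getElem?_of_prefix {α : Type*} {σ σ' : List α} (h : σ <+: σ') {a : ℕ} {x : α}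
    (hx : σ[a]? = some x) : σ'[a]? = some x := by
  obtain ⟨τ, rfl⟩ := h
  obtain ⟨ha, _⟩ := List.getElem?_eq_some_iff.1 hx
  rwa [List.getElem?_append_left ha]

theorem BTree.Stored.mono {σ σ' : Store K} (h : σ <+: σ') {t : BTree K} {p : Option ℕ}
    (ht : t.Stored σ p) : t.Stored σ' p := by
  induction t generalizing p with
  | ext => exact ht
  | node b key child ih =>
    obtain ⟨a, c, hp, ha, hc⟩ := ht
    exact ⟨a, c, hp, getElem?_of_prefix h ha, fun i => ih i (hc i)⟩

theorem TreeAt.mono {σ σ' : Store K} (h : σ <+: σ') {B lo hi n : ℕ} {p : Option ℕ} {l : List K}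
    (ht : TreeAt σ B lo hi n p l) : TreeAt σ' B lo hi n p l := by
  obtain ⟨t, h1, h2⟩ := ht
  exact ⟨t, h1.mono h, h2⟩

theorem TreeAt.weaken {σ : Store K} {B lo hi lo' hi' n : ℕ} {p : Option ℕ} {l : List K}
    (ht : TreeAt σ B lo hi n p l) (hlo : lo' ≤ lo) (hhi : hi ≤ hi') :
    TreeAt σ B lo' hi' n p l := by
  obtain ⟨t, h1, h2, h3⟩ := ht
  refine ⟨t, h1, ?_, h3⟩
  cases t with
  | ext => trivial
  | node => exact ⟨hlo.trans h2.1, h2.2.1.trans hhi, h2.2.2⟩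

namespace Entries

variable {σ : Store K} {B h : ℕ}

theorem mono {σ' : Store K} (hσ : σ <+: σ') {s e : Bool} {ws : List (Word K)} {l : List K}
    (H : Entries σ B h s e ws l) : Entries σ' B h s e ws l := by
  induction H with
  | nil s => exact .nil s
  | key k _ ih => exact .key k ih
  | tree ht _ ih => exact .tree (ht.mono hσ) ih

theorem append {s m e : Bool} {ws ws' : List (Word K)} {l l' : List K}
    (H : Entries σ B h s m ws l) (H' : Entries σ B h m e ws' l') :
    Entries σ B h s e (ws ++ ws') (l ++ l') := by
  induction H with
  | nil s => exact H'
  | key k _ ih => exact .key k (ih H')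
  | tree ht _ ih => rw [List.append_assoc]; exact .tree ht (ih H')

theorem split {s e : Bool} {ws ws' : List (Word K)} {l : List K}
    (H : Entries σ B h s e (ws ++ ws') l) :
    ∃ m l₁ l₂, Entries σ B h s m ws l₁ ∧ Entries σ B h m e ws' l₂ ∧ l = l₁ ++ l₂ := by
  induction ws generalizing s l with
  | nil => exact ⟨s, [], l, .nil s, H, rfl⟩
  | cons w ws ih =>
    cases H with
    | key k H =>
      obtain ⟨m, l₁, l₂, h1, h2, rfl⟩ := ih H
      exact ⟨m, _, l₂, .key k h1, h2, rfl⟩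
    | tree ht H =>
      obtain ⟨m, l₁, l₂, h1, h2, rfl⟩ := ih H
      exact ⟨m, _, l₂, .tree ht h1, h2, (List.append_assoc ..).symm⟩

/-- Pointers and keys alternate, so parity alone tells what kind of word follows a cut. -/
theorem even_length {s e : Bool} {ws : List (Word K)} {l : List K}
    (H : Entries σ B h s e ws l) : Even ws.length ↔ s = e := by
  induction H with
  | nil s => simp
  | @key e _ _ k _ ih => rw [List.length_cons, Nat.even_add_one, ih]; cases e <;> simp
  | @tree e _ _ _ _ _ _ ih => rw [List.length_cons, Nat.even_add_one, ih]; cases e <;> simp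

theorem split_odd {s e : Bool} {ws ws' : List (Word K)} {l : List K}
    (H : Entries σ B h s e (ws ++ ws') l) (hws : ¬ Even ws.length) :
    ∃ l₁ l₂, Entries σ B h s (!s) ws l₁ ∧ Entries σ B h (!s) e ws' l₂ ∧ l = l₁ ++ l₂ := by
  obtain ⟨m, l₁, l₂, h1, h2, h3⟩ := H.split
  have : m = !s := by
    have := mt h1.even_length.2 hws
    cases s <;> cases m <;> simp_all
  subst this
  exact ⟨l₁, l₂, h1, h2, h3⟩

theorem ofFn {b : ℕ} (k : Fin b → K) (c : Fin b → Option ℕ) (L : Fin b → List K)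
    (H : ∀ i, TreeAt σ B (B / 2) B h (c i) (L i)) :
    Entries σ B h false false (List.ofFn fun i => [Word.key (k i), .ptr (c i)]).flatten
      (List.ofFn fun i => k i :: L i).flatten := by
  induction b with
  | zero => exact .nil _
  | succ b ih =>
    simp only [List.ofFn_succ, List.flatten_cons]
    exact .key _ (.tree (H 0) (ih _ _ _ fun i => H i.succ))

/-- Recovers `Fin`-indexed node data from words. The prefix `w`, a single pointer or nothing
depending on `s`, lets one induction treat both states. -/
theorem exists_ofFn {s e : Bool} {ws : List (Word K)} {l : List K}
    (H : Entries σ B h s e ws l) (he : e = false) :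
    ∃ (w : List (Word K)) (x : List K) (b : ℕ) (k : Fin b → K) (c : Fin b → Option ℕ)
      (L : Fin b → List K), (∀ i, TreeAt σ B (B / 2) B h (c i) (L i)) ∧
      ws = w ++ (List.ofFn fun i => [Word.key (k i), .ptr (c i)]).flatten ∧
      l = x ++ (List.ofFn fun i => k i :: L i).flatten ∧
      if s then ∃ p, w = [.ptr p] ∧ TreeAt σ B (B / 2) B h p x else w = [] ∧ x = [] := by
  induction H with
  | nil s =>
    subst he
    exact ⟨[], [], 0, Fin.elim0, Fin.elim0, Fin.elim0, fun i => i.elim0, rfl, rfl, by simp⟩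
  | key k₀ _ ih =>
    obtain ⟨w, x, b, k, c, L, hT, rfl, rfl, h⟩ := ih he
    obtain ⟨p, rfl, hp⟩ := h
    refine ⟨[], [], b + 1, Fin.cons k₀ k, Fin.cons p c, Fin.cons x L, ?_, ?_, ?_, by simp⟩
    · exact Fin.cases hp hT
    · simp [List.ofFn_succ]
    · simp [List.ofFn_succ]
  | @tree _ _ _ p l' ht _ ih =>
    obtain ⟨w, x, b, k, c, L, hT, rfl, rfl, h⟩ := ih he
    obtain ⟨rfl, rfl⟩ : w = [] ∧ x = [] := by simpa using h
    exact ⟨[.ptr p], l', b, k, c, L, hT, rfl, rfl, by simpa using ht⟩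

theorem length_ofFn {b : ℕ} (k : Fin b → K) (c : Fin b → Option ℕ) :
    (List.ofFn fun i => [Word.key (k i), .ptr (c i)]).flatten.length = 2 * b := by
  induction b with
  | zero => rfl
  | succ b ih =>
    simp only [List.ofFn_succ, List.flatten_cons, List.length_append, List.length_cons,
      List.length_nil, ih]
    omega

end Entries

theorem treeAt_zero {σ : Store K} {B lo hi : ℕ} {p : Option ℕ} {l : List K} :
    TreeAt σ B lo hi 0 p l ↔ p = none ∧ l = [] := by
  constructor
  · rintro ⟨t, h1, h2, h3, rfl⟩
    cases t with
    | ext => exact ⟨h1, rfl⟩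
    | node => simp [BTree.height] at h3
  · rintro ⟨rfl, rfl⟩
    exact ⟨.ext, rfl, trivial, rfl, rfl⟩

/-- A node with `b` keys is a block of `2 * b + 1` words. From here on trees are handled only
through blocks, apart from the final translation. -/
theorem treeAt_succ {σ : Store K} {B lo hi h : ℕ} {p : Option ℕ} {l : List K} :
    TreeAt σ B lo hi (h + 1) p l ↔ ∃ a ws, p = some a ∧ σ[a]? = some ws ∧
      Entries σ B h true false ws l ∧ 2 * lo + 1 ≤ ws.length ∧ ws.length ≤ 2 * hi + 1 := by
  constructor
  · rintro ⟨t, h1, h2, h3, rfl⟩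
    cases t with
    | ext => simp [BTree.height] at h3
    | node b key child =>
      obtain ⟨a, c, rfl, ha, hc⟩ := h1
      obtain ⟨hlo, hhi, hh, hs⟩ := h2
      have h0 : (child 0).height = h := by simpa [BTree.height] using h3
      have hT : ∀ i, TreeAt σ B (B / 2) B h (c i) (child i).inorder := fun i =>
        ⟨child i, hc i, hs i, (hh i).trans h0, rfl⟩
      refine ⟨a, _, rfl, ha, .tree (hT 0) (Entries.ofFn _ _ _ fun i => hT i.succ), ?_⟩
      rw [nodeBlock, List.length_cons, Entries.length_ofFn]
      omega
  · rintro ⟨a, ws, rfl, ha, H, hlo, hhi⟩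
    obtain ⟨w, x, b, k, c, L, hT, rfl, rfl, h⟩ := H.exists_ofFn rfl
    obtain ⟨p, rfl, hp⟩ := h
    rw [List.length_append, Entries.length_ofFn, List.length_singleton] at hlo hhi
    obtain ⟨t₀, ht₀, hs₀, hh₀, rfl⟩ := hp
    choose t ht hs hh hL using hT
    refine ⟨.node b k (Fin.cons t₀ t), ⟨a, Fin.cons p c, rfl, ?_, ?_⟩, ⟨?_, ?_, ?_, ?_⟩, ?_, ?_⟩
    · simpa [nodeBlock] using ha
    · exact Fin.cases ht₀ ht
    · omega
    · omega
    · exact Fin.cases rfl fun i => by simp [hh, hh₀]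
    · exact Fin.cases hs₀ hs
    · simp [BTree.height, hh₀]
    · simp [BTree.inorder, hL]

/-! ### Specifications of programs -/

/-- Started in the memory `σ`, the program only adds blocks, its work, span and width are at most
`W`, `S` and `D`, and `Φ` holds of the returned words and the final memory. -/
def Prog.Sat (P : Prog K) (σ : Store K) (W S D : ℕ) (Φ : List (Word K) → Store K → Prop) :
    Prop :=
  σ <+: (P.run σ).store ∧ (P.run σ).work ≤ W ∧ (P.run σ).span ≤ S ∧ (P.run σ).width ≤ D ∧
    Φ (P.run σ).val (P.run σ).store

/-- Combined outcome of the parallel threads in a list. -/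
def runList : List (Prog K) → Store K → Outcome K (List (List (Word K)))
  | [], σ => ⟨[], σ, 0, 0, 0⟩
  | P :: Ps, σ =>
      let r := P.run σ
      let s := runList Ps r.store
      ⟨r.val :: s.val, s.store, r.work + s.work, max r.span s.span, max r.width s.width⟩

theorem runThreads_eq_runList (n : ℕ) (t : Fin n → Prog K) (σ : Store K) :
    runThreads n (fun i => (t i).run) σ = runList (List.ofFn t) σ := by
  induction n generalizing σ with
  | zero => rfl
  | succ n ih =>
    rw [List.ofFn_succ, runThreads, runList, ih fun i => t i.succ]

/-- The analogue of `Prog.Sat` for a list of parallel threads. -/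
def ParSat (Ps : List (Prog K)) (σ : Store K) (W S D : ℕ)
    (Ψ : List (List (Word K)) → Store K → Prop) : Prop :=
  σ <+: (runList Ps σ).store ∧ (runList Ps σ).work ≤ W ∧ (runList Ps σ).span ≤ S ∧
    (runList Ps σ).width ≤ D ∧ Ψ (runList Ps σ).val (runList Ps σ).store

namespace Prog.Sat

variable {σ : Store K} {W S D : ℕ} {Φ : List (Word K) → Store K → Prop}

theorem weaken {P : Prog K} {W' S' D' : ℕ} {Φ' : List (Word K) → Store K → Prop}
    (H : P.Sat σ W S D Φ) (hW : W ≤ W') (hS : S ≤ S') (hD : D ≤ D')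
    (hΦ : ∀ ws σ', σ <+: σ' → Φ ws σ' → Φ' ws σ') : P.Sat σ W' S' D' Φ' :=
  ⟨H.1, H.2.1.trans hW, H.2.2.1.trans hS, H.2.2.2.1.trans hD, hΦ _ _ H.1 H.2.2.2.2⟩

theorem ret {ws : List (Word K)} (H : Φ ws σ) : (Prog.ret ws).Sat σ 0 S D Φ :=
  ⟨List.prefix_rfl, le_rfl, Nat.zero_le _, Nat.zero_le _, H⟩

theorem read {a : ℕ} {ws : List (Word K)} {k : List (Word K) → Prog K} (ha : σ[a]? = some ws)
    (hD : ws.length ≤ D) (H : (k ws).Sat σ W S D Φ) :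
    (Prog.read a k).Sat σ (1 + W) (1 + S) D Φ := by
  have e : σ.getD a [] = ws := by rw [List.getD_eq_getElem?_getD, ha]; rfl
  obtain ⟨h1, h2, h3, h4, h5⟩ := H
  simp only [Prog.Sat, Prog.run, e]
  exact ⟨h1, by omega, by omega, max_le hD h4, h5⟩

theorem alloc {ws : List (Word K)} {k : ℕ → Prog K} (hD : ws.length ≤ D)
    (H : ∀ a σ', σ <+: σ' → σ'[a]? = some ws → (k a).Sat σ' W S D Φ) :
    (Prog.alloc ws k).Sat σ (1 + W) (1 + S) D Φ := by
  have hp : σ <+: σ ++ [ws] := List.prefix_append ..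
  obtain ⟨h1, h2, h3, h4, h5⟩ := H σ.length _ hp (by simp)
  simp only [Prog.Sat, Prog.run]
  exact ⟨hp.trans h1, by omega, by omega, max_le hD h4, h5⟩

theorem fork {n : ℕ} {t : Fin n → Prog K} {k : List (List (Word K)) → Prog K} {W' S' : ℕ}
    {Ψ : List (List (Word K)) → Store K → Prop} (H : ParSat (List.ofFn t) σ W S D Ψ)
    (hn : n ≤ D) (hΨ : ∀ vs σ', σ <+: σ' → Ψ vs σ' → vs.flatten.length ≤ D ∧
      (k vs).Sat σ' W' S' D Φ) :
    (Prog.fork n t k).Sat σ (n + W + W') (1 + S + S') D Φ := by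
  rw [ParSat, ← runThreads_eq_runList] at H
  obtain ⟨h1, h2, h3, h4, h5⟩ := H
  obtain ⟨hD, g1, g2, g3, g4, g5⟩ := hΨ _ _ h1 h5
  simp only [Prog.Sat, Prog.run]
  exact ⟨h1.trans g1, by omega, by omega, max_le (max_le hn hD) (max_le h4 g4), g5⟩

theorem parFor {α : Type*} {l : List α} {f : α → Prog K} {k : List (List (Word K)) → Prog K}
    {W' S' : ℕ} {Ψ : List (List (Word K)) → Store K → Prop} (H : ParSat (l.map f) σ W S D Ψ)
    (hn : l.length ≤ D) (hΨ : ∀ vs σ', σ <+: σ' → Ψ vs σ' → vs.flatten.length ≤ D ∧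
      (k vs).Sat σ' W' S' D Φ) :
    (Prog.parFor l f k).Sat σ (l.length + W + W') (1 + S + S') D Φ := by
  refine fork ?_ hn hΨ
  have : (List.ofFn fun i => f (l.get i)) = l.map f := by
    conv_rhs => rw [← List.ofFn_get l, List.map_ofFn]
    rfl
  rwa [this]

end Prog.Sat

namespace ParSat

variable {σ : Store K} {W S D : ℕ} {Ψ : List (List (Word K)) → Store K → Prop}

theorem weaken {Ps : List (Prog K)} {W' S' D' : ℕ} {Ψ' : List (List (Word K)) → Store K → Prop}
    (H : ParSat Ps σ W S D Ψ) (hW : W ≤ W') (hS : S ≤ S') (hD : D ≤ D')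
    (hΨ : ∀ vs σ', σ <+: σ' → Ψ vs σ' → Ψ' vs σ') : ParSat Ps σ W' S' D' Ψ' :=
  ⟨H.1, H.2.1.trans hW, H.2.2.1.trans hS, H.2.2.2.1.trans hD, hΨ _ _ H.1 H.2.2.2.2⟩

theorem nil (H : Ψ [] σ) : ParSat [] σ 0 S D Ψ :=
  ⟨List.prefix_rfl, le_rfl, Nat.zero_le _, Nat.zero_le _, H⟩

/-- The first thread's postcondition holds in the memory `σ'` that it leaves; `hΨ` has to carry it
over to the final memory `σ''`. -/
theorem cons {P : Prog K} {Ps : List (Prog K)} {W' : ℕ} {Φ : List (Word K) → Store K → Prop}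
    {Ψ' : List (List (Word K)) → Store K → Prop} (hP : P.Sat σ W S D Φ)
    (hPs : ∀ σ', σ <+: σ' → ParSat Ps σ' W' S D Ψ)
    (hΨ : ∀ v vs σ' σ'', σ <+: σ' → σ' <+: σ'' → Φ v σ' → Ψ vs σ'' → Ψ' (v :: vs) σ'') :
    ParSat (P :: Ps) σ (W + W') S D Ψ' := by
  obtain ⟨h1, h2, h3, h4, h5⟩ := hP
  obtain ⟨g1, g2, g3, g4, g5⟩ := hPs _ h1
  simp only [ParSat, runList]
  exact ⟨h1.trans g1, by omega, max_le h3 g3, max_le h4 g4, hΨ _ _ _ _ h1 g1 h5 g5⟩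

end ParSat

/-! ### Collecting words from blocks -/

/-- The pieces `ps` stand for the words `ws`. -/
inductive PieceWords (σ : Store K) (D : ℕ) : List (Piece K) → List (Word K) → Prop
  | nil : PieceWords σ D [] []
  | lit {ps ws} (w : List (Word K)) : PieceWords σ D ps ws →
      PieceWords σ D (.lit w :: ps) (w ++ ws)
  | slice {ps ws a blk start len} : σ[a]? = some blk → blk.length ≤ D →
      start + len ≤ blk.length → PieceWords σ D ps ws →
      PieceWords σ D (.slice a start len :: ps) ((blk.drop start).take len ++ ws)

/-- The number of pieces that end at or before position `i`. -/
def piecesBefore : List (Piece K) → ℕ → ℕ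
  | [], _ => 0
  | p :: ps, i => if p.length ≤ i then 1 + piecesBefore ps (i - p.length) else 0

theorem piecesBefore_le (ps : List (Piece K)) (i : ℕ) : piecesBefore ps i ≤ ps.length := by
  induction ps generalizing i with
  | nil => exact le_rfl
  | cons p ps ih =>
    rw [piecesBefore, List.length_cons]
    split
    · have := ih (i - p.length); omega
    · omega

/-- Besides the pieces that end within the cut, at most one more is touched. In this form the bounds
for consecutive cuts telescope, so `q` cuts touch at most `ps.length + q` pieces in total. -/
theorem length_cutPieces (ps : List (Piece K)) (i n : ℕ) :
    (cutPieces ps i n).length + piecesBefore ps i ≤ piecesBefore ps (i + n) + 1 := by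
  induction ps generalizing i n with
  | nil => simp [cutPieces, piecesBefore]
  | cons p ps ih =>
    rw [cutPieces]
    by_cases hn : n = 0
    · simp [hn]
    rw [if_neg hn]
    by_cases hp : p.length ≤ i
    · have := ih (i - p.length) n
      rw [if_pos hp, piecesBefore, piecesBefore, if_pos hp, if_pos (by omega),
        show i + n - p.length = i - p.length + n by omega]
      omega
    · rw [if_neg hp, piecesBefore, piecesBefore, if_neg hp, List.length_cons]
      by_cases hpn : p.length ≤ i + n
      · have := ih 0 (n - (p.length - i))
        rw [if_pos hpn, show i + n - p.length = 0 + (n - (p.length - i)) by omega]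
        omega
      · rw [if_neg hpn, show n - (p.length - i) = 0 by omega]
        cases ps <;> simp [cutPieces]

namespace PieceWords

variable {σ : Store K} {D : ℕ} {ps : List (Piece K)} {ws : List (Word K)}

theorem mono {σ' : Store K} (h : σ <+: σ') (H : PieceWords σ D ps ws) :
    PieceWords σ' D ps ws := by
  induction H with
  | nil => exact .nil
  | lit w _ ih => exact .lit w ih
  | slice ha hb hl _ ih => exact .slice (getElem?_of_prefix h ha) hb hl ih

theorem sum_length (H : PieceWords σ D ps ws) : (ps.map Piece.length).sum = ws.length := by
  induction H with
  | nil => rfl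
  | lit w _ ih => simp [Piece.length, ih]
  | slice ha hb hl _ ih => simp [Piece.length, ih]; omega

theorem cut (H : PieceWords σ D ps ws) (i n : ℕ) :
    PieceWords σ D (cutPieces ps i n) ((ws.drop i).take n) := by
  induction H generalizing i n with
  | nil => simpa [cutPieces] using PieceWords.nil
  | @lit ps ws w _ ih =>
    rw [cutPieces]
    by_cases hn : n = 0
    · simpa [hn] using PieceWords.nil
    rw [if_neg hn]
    by_cases hp : w.length ≤ i
    · rw [Piece.length, if_pos hp, List.drop_append, List.drop_eq_nil_of_le hp, List.nil_append]
      exact ih _ _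
    · have e : (((w ++ ws).drop i).take n) =
          (w.drop i).take n ++ (ws.drop 0).take (n - (w.length - i)) := by
        rw [List.drop_append, List.take_append, List.length_drop,
          show i - w.length = 0 by omega]
      rw [Piece.length, if_neg hp, e]
      exact .lit _ (ih _ _)
  | @slice ps ws a blk start len ha hb hl _ ih =>
    rw [cutPieces]
    have hlen : ((blk.drop start).take len).length = len := by
      rw [List.length_take, List.length_drop]; omega
    by_cases hn : n = 0
    · simpa [hn] using PieceWords.nil
    rw [if_neg hn]
    by_cases hp : len ≤ i
    · rw [Piece.length, if_pos hp, List.drop_append, hlen,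
        List.drop_eq_nil_of_le (by omega), List.nil_append]
      exact ih _ _
    · have e : ((((blk.drop start).take len ++ ws).drop i).take n) =
          (blk.drop (start + i)).take (min n (len - i)) ++
            (ws.drop 0).take (n - (len - i)) := by
        rw [List.drop_append, hlen, List.take_append, List.length_drop, hlen,
          show i - len = 0 by omega, List.drop_take, List.take_take, List.drop_drop]
      rw [Piece.length, if_neg hp, e]
      exact .slice ha hb (by omega) (ih _ _)

/-- Each piece costs one unit for its thread and at most one block read. -/
theorem gather_sat {D' W S : ℕ} {k : List (Word K) → Prog K}
    {Φ : List (Word K) → Store K → Prop} (H : PieceWords σ D ps ws)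
    (hps : ps.length ≤ D') (hws : ws.length ≤ D') (hD : D ≤ D')
    (hk : ∀ σ', σ <+: σ' → (k ws).Sat σ' W S D' Φ) :
    (gather ps k).Sat σ (2 * ps.length + W) (2 + S) D' Φ := by
  refine (Prog.Sat.parFor (W := ps.length) (S := 1) (Ψ := fun vs _ => vs.flatten = ws)
    (W' := W) (S' := S) ?_ hps ?_).weaken (by omega) (by omega) le_rfl fun _ _ _ h => h
  · clear hps hws hk
    suffices ∀ σ', σ <+: σ' → ParSat (ps.map _) σ' ps.length 1 D' (fun vs _ => vs.flatten = ws)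
      from this _ List.prefix_rfl
    induction H with
    | nil => exact fun _ _ => .nil rfl
    | @lit ps ws w _ ih =>
      intro σ' hσ
      refine (ParSat.cons (D := D') (Φ := fun v _ => v = w) (.ret rfl) (fun σ'' h => ih σ'' (hσ.trans h))
        ?_).weaken (W' := (_ :: ps).length) ?_ le_rfl le_rfl fun _ _ _ h => h
      · rintro v vs - - - - rfl rfl; rfl
      · simp
    | @slice ps ws a blk start len ha hb hl _ ih =>
      intro σ' hσ
      refine (ParSat.cons (D := D') (Φ := fun v _ => v = (blk.drop start).take len)
        (.read (S := 0) (k := fun blk => .ret ((blk.drop start).take len))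
          (getElem?_of_prefix hσ ha) (by omega) (.ret rfl)) (fun σ'' h => ih σ'' (hσ.trans h))
        ?_).weaken (W' := (_ :: ps).length) ?_ le_rfl le_rfl fun _ _ _ h => h
      · rintro v vs - - - - rfl rfl; rfl
      · simp; omega
  · rintro vs σ' hσ rfl
    exact ⟨hws, hk σ' hσ⟩

end PieceWords

/-! ### Rebalancing -/

/-- The possible results `X` of a join at height `h` with `n` separator keys: a tree of height
`h` whose root has at least `lo` keys, or a tree of height `h + 1` whose root has at most `n`
keys. -/
def JoinResult (σ : Store K) (B lo h n : ℕ) (X : Ref) (l : List K) : Prop :=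
  X.height = h ∧ TreeAt σ B lo B h X.root l ∨
    X.height = h + 1 ∧ TreeAt σ B 1 n (h + 1) X.root l

theorem JoinResult.mono {σ σ' : Store K} (hσ : σ <+: σ') {B lo h n : ℕ} {X : Ref} {l : List K}
    (H : JoinResult σ B lo h n X l) : JoinResult σ' B lo h n X l :=
  H.imp (fun H => ⟨H.1, H.2.mono hσ⟩) fun H => ⟨H.1, H.2.mono hσ⟩

section Rebalance

variable {σ : Store K} {B D D' h : ℕ} {ps : List (Piece K)} {ws : List (Word K)}

/-- A part has `d` pointers, hence `2 * d - 1` words `v` for the new node; `tail` is the key to be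
promoted, or empty for the last part. -/
theorem part_sat {lo s d : ℕ} {v tail : List (Word K)} {l : List K} (H : PieceWords σ D ps ws)
    (hcut : (cutPieces ps (2 * s) (2 * d)).length ≤ D') (hD : D ≤ D') (hB : 2 * B + 2 ≤ D')
    (hv : (ws.drop (2 * s)).take (2 * d) = v ++ tail) (hvd : v.length = 2 * d - 1)
    (hlo : lo + 1 ≤ d) (hhi : d ≤ B + 1) (hl : Entries σ B h true false v l) :
    (gather (cutPieces ps (2 * s) (2 * d)) fun ws =>
        .alloc (ws.take (2 * d - 1)) fun a => .ret (.ptr (some a) :: ws.drop (2 * d - 1))).Sat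
      σ (2 * (cutPieces ps (2 * s) (2 * d)).length + 1) 3 D'
      fun w σ' => ∃ a, w = .ptr (some a) :: tail ∧ TreeAt σ' B lo B (h + 1) (some a) l := by
  have hlen : (v ++ tail).length ≤ D' := by
    rw [← hv]; exact (List.length_take_le _ _).trans (by omega)
  have e1 : (v ++ tail).take (2 * d - 1) = v := by rw [← hvd, List.take_left']; rfl
  have e2 : (v ++ tail).drop (2 * d - 1) = tail := by rw [← hvd, List.drop_left']; rfl
  refine ((H.cut (2 * s) (2 * d)).gather_sat (W := 1 + 0) (S := 1 + 0) hcut (by rwa [hv]) hD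
    fun σ' hσ => ?_)
  rw [hv, e1, e2]
  refine .alloc (by rw [hvd]; omega) fun a σ'' hσ' ha => .ret ⟨a, rfl, treeAt_succ.2
    ⟨a, v, rfl, ha, (hl.mono hσ).mono hσ', by omega, by omega⟩⟩

/-- Induction on the number `n` of parts still to be made, starting with part `j`. Subtracting
`piecesBefore` in the work bound is what makes the numbers of touched pieces telescope. -/
theorem parts_sat {q : ℕ} {s : ℕ → ℕ} (H : PieceWords σ D ps ws) (hps : ps.length + 1 ≤ D')
    (hD : D ≤ D') (hB : 2 * B + 2 ≤ D')
    (hs : ∀ j < q, s j + B / 2 + 1 ≤ s (j + 1) ∧ s (j + 1) ≤ s j + B + 1)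
    (hsq : ∀ j < q, s j < s q) (hq : ws.length + 1 = 2 * s q) (n : ℕ) (hn : 1 ≤ n) :
    ∀ (j : ℕ) (l : List K) (σ' : Store K), j + n = q → σ <+: σ' →
      Entries σ' B h true false (ws.drop (2 * s j)) l →
      ParSat (List.ofFn fun i : Fin n =>
        let d := s (j + i + 1) - s (j + i)
        gather (cutPieces ps (2 * s (j + i)) (2 * d)) fun ws =>
          .alloc (ws.take (2 * d - 1)) fun a => .ret (.ptr (some a) :: ws.drop (2 * d - 1)))
        σ' (2 * (ps.length + n - piecesBefore ps (2 * s j)) + n) 3 D'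
        fun vs σ'' => Entries σ'' B (h + 1) true false vs.flatten l ∧
          vs.flatten.length + 1 = 2 * n := by
  have cut_le : ∀ j < q, (cutPieces ps (2 * s j) (2 * (s (j + 1) - s j))).length +
      piecesBefore ps (2 * s j) ≤ piecesBefore ps (2 * s (j + 1)) + 1 := by
    intro j hj
    have := length_cutPieces ps (2 * s j) (2 * (s (j + 1) - s j))
    rwa [show 2 * s j + 2 * (s (j + 1) - s j) = 2 * s (j + 1) by have := hs j hj; omega] at this
  induction n, hn using Nat.le_induction with
  | base =>
    rintro j l σ' hj hσ hl
    have h1 := hs j (by omega)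
    have h2 := cut_le j (by omega)
    have h3 := piecesBefore_le ps (2 * s (j + 1))
    have h4 := piecesBefore_le ps (2 * s j)
    rw [List.ofFn_succ, List.ofFn_zero]
    subst hj
    refine (ParSat.cons (part_sat (tail := []) (lo := B / 2) (H.mono hσ) (by simp; omega) hD hB
      ?_ ?_ (by simp; omega) (by simp; omega) hl)
      (fun σ'' _ => ParSat.nil (Ψ := fun vs _ => vs = []) rfl) ?_).weaken ?_ le_rfl le_rfl
      fun _ _ _ h => h
    -- The last part asks for `2 * d` words but only `2 * d - 1` are left, so nothing is promoted.
    · simp only [Fin.val_zero, Nat.add_zero, List.append_nil]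
      exact List.take_of_length_le (by rw [List.length_drop]; omega)
    · simp only [Fin.val_zero, Nat.add_zero, List.length_drop]; omega
    · rintro v vs σ1 σ2 h1 h2 ⟨a, rfl, ha⟩ rfl
      have := Entries.tree (ha.mono h2) (Entries.nil (σ := σ2) (B := B) (h := h + 1) false)
      rw [List.append_nil] at this
      exact ⟨this, rfl⟩
    · simp; omega
  | succ n hn ih =>
    rintro j l σ' hj hσ hl
    have h1 := hs j (by omega)
    have h2 := cut_le j (by omega)
    have h3 := piecesBefore_le ps (2 * s (j + 1))
    have h4 := piecesBefore_le ps (2 * s j)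
    have h5 := hsq (j + 1) (by omega)
    set d := s (j + 1) - s j with hd
    set v := (ws.drop (2 * s j)).take (2 * d - 1) with hv
    have hvlen : v.length = 2 * d - 1 := by
      rw [hv, List.length_take, List.length_drop]; omega
    have e1 : ws.drop (2 * s j) = v ++ ws.drop (2 * s (j + 1) - 1) := by
      rw [hv, show 2 * s (j + 1) - 1 = 2 * s j + (2 * d - 1) by omega, ← List.drop_drop,
        List.take_append_drop]
    have hlt : 2 * s (j + 1) - 1 < ws.length := by omega
    have e2 := List.drop_eq_getElem_cons hlt
    rw [show 2 * s (j + 1) - 1 + 1 = 2 * s (j + 1) by omega] at e2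
    rw [e1, e2] at hl
    -- The node takes an odd number of words, so the word after it is a key, the one to be promoted.
    obtain ⟨l₁, l₂, g1, g2, rfl⟩ := hl.split_odd
      (by rw [hvlen, Nat.not_even_iff_odd]; exact ⟨d - 1, by omega⟩)
    obtain ⟨k, l₃, hk, g3, rfl⟩ : ∃ k l₃, ws[2 * s (j + 1) - 1] = .key k ∧
        Entries σ' B h true false (ws.drop (2 * s (j + 1))) l₃ ∧ l₂ = k :: l₃ := by
      generalize ws[2 * s (j + 1) - 1] = w at g2
      cases g2 with
      | key k g => exact ⟨k, _, rfl, g, rfl⟩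
    rw [hk] at e2
    rw [List.ofFn_succ]
    refine (ParSat.cons (part_sat (tail := [Word.key k]) (lo := B / 2) (v := v) (H.mono hσ)
      (by simp [← hd]; omega) hD hB ?_ (by simpa using hvlen) (by simp; omega) (by simp; omega) g1)
      (W' := 2 * (ps.length + n - piecesBefore ps (2 * s (j + 1))) + n)
      (Ψ := fun vs σ'' => Entries σ'' B (h + 1) true false vs.flatten l₃ ∧
          vs.flatten.length + 1 = 2 * n)
      (fun σ'' hσ'' => ?_) ?_).weaken ?_ le_rfl le_rfl fun _ _ _ h => h
    · simp only [Fin.val_zero, Nat.add_zero]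
      rw [← hd, e1, e2, List.take_append, List.take_of_length_le (by omega), hvlen,
        show 2 * d - (2 * d - 1) = 1 by omega]
      rfl
    · have := ih (j + 1) l₃ σ'' (by omega) (hσ.trans hσ'') (g3.mono hσ'')
      have e : ∀ i : Fin n, j + (i.succ : ℕ) = j + 1 + i := fun i => by rw [Fin.val_succ]; omega
      simpa only [e] using this
    · rintro v vs σ1 σ2 h1 h2 ⟨a, rfl, ha⟩ ⟨h5, h6⟩
      refine ⟨.tree (ha.mono h2) (.key k h5), ?_⟩
      simp at h6 ⊢; omega
    · simp only [Fin.val_zero, Nat.add_zero, ← hd]; omega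

/-- With `c` pointers, `hhi` says `c + B < (n + 2) * (B + 1)`, so at most `n + 1` nodes arise and at
most `n` keys are promoted. -/
theorem simpleRebalance_sat {lo n : ℕ} {l : List K} (H : PieceWords σ D ps ws)
    (hl : Entries σ B h true false ws l) (hps : ps.length + 1 ≤ D') (hD : D ≤ D')
    (hB : 2 * B + 2 ≤ D') (hn : 2 * n + 1 ≤ D') (hlo : 2 * lo + 1 ≤ ws.length)
    (hhi : ws.length + 2 * B + 1 < 2 * ((n + 2) * (B + 1))) :
    (simpleRebalance B (h + 1) ps).Sat σ (2 * ps.length + 4 * n + 5) 5 D'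
      fun v σ' => ∃ X : Ref, v = X.words ∧ JoinResult σ' B lo (h + 1) n X l := by
  have hodd : ¬ Even ws.length := by simp [hl.even_length]
  unfold simpleRebalance
  dsimp only
  rw [H.sum_length]
  generalize hc : (ws.length + 1) / 2 = c
  have hc' : ws.length + 1 = 2 * c := by
    obtain ⟨r, hr⟩ := Nat.not_even_iff_odd.1 hodd; omega
  generalize hq : (c + B) / (B + 1) = q
  have hqn : q ≤ n + 1 := by
    have : (c + B) / (B + 1) < n + 2 :=
      (Nat.div_lt_iff_lt_mul (show 0 < B + 1 by omega)).2 (by omega)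
    omega
  have hcq : c ≤ q * (B + 1) := by
    have := Nat.lt_mul_div_succ (c + B) (Nat.succ_pos B)
    rw [Nat.succ_eq_add_one, hq, mul_comm] at this
    linarith
  have hqc : q * (B + 1) ≤ c + B := by rw [← hq]; exact Nat.div_mul_le_self _ _
  have hq1 : 1 ≤ q := by
    rcases Nat.eq_zero_or_pos q with rfl | h
    · omega
    · exact h
  by_cases h1 : q = 1
  · subst h1
    have hcB : c ≤ B + 1 := by omega
    have hcut := length_cutPieces ps (2 * 0) (2 * c)
    have := piecesBefore_le ps (2 * 0 + 2 * c)
    refine (Prog.Sat.fork (W := (2 * ps.length + 3)) (S := 3) (W' := 0) (S' := 0)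
      (Ψ := fun vs σ' => ∃ a, vs = [[.ptr (some a)]] ∧ TreeAt σ' B lo B (h + 1) (some a) l)
      ?_ (by omega) ?_).weaken (by omega) (by omega) le_rfl fun _ _ _ h => h
    · rw [List.ofFn_succ, List.ofFn_zero]
      refine (ParSat.cons (W := 2 * (cutPieces ps (2 * 0) (2 * c)).length + 1)
        (Φ := fun w σ' => ∃ a, w = .ptr (some a) :: [] ∧ TreeAt σ' B lo B (h + 1) (some a) l)
        ?_ (fun σ'' _ => ParSat.nil (Ψ := fun vs _ => vs = []) rfl) ?_).weaken
        (by omega) le_rfl le_rfl fun _ _ _ h => h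
      · simp only [Fin.val_zero, zero_mul, zero_add, one_mul, Nat.div_one,
          Nat.sub_zero]
        refine part_sat (v := ws) H (by omega) hD hB ?_ (by omega) (by omega) hcB hl
        simp only [mul_zero, List.drop_zero, List.append_nil]
        exact List.take_of_length_le (by omega)
      · rintro v vs σ1 σ2 - h2 ⟨a, rfl, ha⟩ rfl
        exact ⟨a, rfl, ha.mono h2⟩
    · rintro vs σ' - ⟨a, rfl, ha⟩
      exact ⟨by simp; omega, .ret ⟨⟨some a, h + 1⟩, rfl, Or.inl ⟨rfl, ha⟩⟩⟩
  · have hq2 : 2 ≤ q := by omega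
    -- Minimality of `q` gives `q * (B + 1) ≤ c + B`; for `q ≥ 2` the surplus `q * (B - B / 2)` over
    -- `q * (B / 2 + 1)` absorbs `B`.
    have hlow : q * (B / 2 + 1) ≤ c := by
      have h3 : 2 * (B - B / 2) ≤ q * (B - B / 2) := Nat.mul_le_mul_right _ hq2
      have h4 : q * (B + 1) = q * (B / 2 + 1) + q * (B - B / 2) := by
        rw [← Nat.mul_add]; congr 1; omega
      omega
    -- As `c / q` lies between `B / 2 + 1` and `B + 1`, so do the differences of the rounded
    -- multiples: each part has a legal number of pointers.
    have hs : ∀ j < q, j * c / q + B / 2 + 1 ≤ (j + 1) * c / q ∧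
        (j + 1) * c / q ≤ j * c / q + B + 1 := by
      intro j _
      constructor
      · rw [Nat.le_div_iff_mul_le hq1]
        have := Nat.div_mul_le_self (j * c) q
        linarith
      · rw [← Nat.lt_succ_iff, Nat.div_lt_iff_lt_mul hq1]
        have := Nat.lt_mul_div_succ (j * c) hq1
        simp only [Nat.succ_eq_add_one] at *
        linarith
    have hsq : ∀ j < q, j * c / q < q * c / q := by
      intro j hj
      refine lt_of_lt_of_le ?_ (Nat.div_le_div_right (Nat.mul_le_mul_right c hj))
      have := (hs j hj).1
      simp only [Nat.succ_eq_add_one]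
      omega
    have hqq : q * c / q = c := Nat.mul_div_cancel_left c hq1
    have key := parts_sat (s := fun j => j * c / q) H hps hD hB hs hsq
      (by simpa only [hqq] using hc') q hq1 0 l σ (by omega) List.prefix_rfl
      (by simpa using hl)
    refine (Prog.Sat.fork (S := 3) (W' := 1 + 0) (S' := 1 + 0) (by simpa only [Nat.zero_add] using key)
      (by omega) ?_).weaken ?_ (by omega) le_rfl fun _ _ _ h => h
    · rintro vs σ' hσ ⟨g1, g2⟩
      refine ⟨by omega, ?_⟩
      rw [if_neg h1]
      refine .alloc (by omega) fun a σ'' hσ' ha => .ret ⟨⟨some a, h + 1 + 1⟩, rfl, Or.inr ⟨rfl, ?_⟩⟩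
      exact treeAt_succ.2 ⟨a, _, rfl, ha, g1.mono hσ', by omega, by omega⟩
    · omega

end Rebalance

/-! ### Concatenation -/

/-- The sources `ss` stand for the words `ws`. -/
inductive SourceWords (σ : Store K) (D : ℕ) : List (Source K) → List (Word K) → Prop
  | nil : SourceWords σ D [] []
  | lit {ss ws} (w : List (Word K)) : SourceWords σ D ss ws →
      SourceWords σ D (.lit w :: ss) (w ++ ws)
  | block {ss ws a blk l r} : σ[a]? = some blk → blk.length ≤ D → l.toNat ≤ blk.length →
      SourceWords σ D ss ws → SourceWords σ D (.block (some a) l r :: ss)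
        ((blk.drop l.toNat).take (blk.length - l.toNat - r.toNat) ++ ws)

/-- The piece that `concatenate` makes of a source and the reply to its measurement. -/
def Source.toPiece (s : Source K) (reply : List (Word K)) : Piece K :=
  match s, reply with
  | .lit ws, _ => .lit ws
  | .block (some a) l r, [.num n] => .slice a l.toNat (n - l.toNat - r.toNat)
  | _, _ => .lit []

/-- The thread that measures a source. -/
def Source.measure : Source K → Prog K
  | .lit ws => .ret [.num ws.length]
  | .block p _ _ => .readPtr p fun blk => .ret [.num blk.length]

theorem concatenate_eq (B h : ℕ) (ss : List (Source K)) :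
    concatenate B h ss = .parFor ss Source.measure fun replies =>
      simpleRebalance B h (List.zipWith Source.toPiece ss replies) := rfl

namespace SourceWords

variable {σ : Store K} {D : ℕ} {ss ss' : List (Source K)} {ws ws' : List (Word K)}

theorem mono {σ' : Store K} (h : σ <+: σ') (H : SourceWords σ D ss ws) :
    SourceWords σ' D ss ws := by
  induction H with
  | nil => exact .nil
  | lit w _ ih => exact .lit w ih
  | block ha hb hl _ ih => exact .block (getElem?_of_prefix h ha) hb hl ih

theorem append (H : SourceWords σ D ss ws) (H' : SourceWords σ D ss' ws') :
    SourceWords σ D (ss ++ ss') (ws ++ ws') := by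
  induction H with
  | nil => exact H'
  | lit w _ ih => rw [List.append_assoc]; exact .lit w ih
  | block ha hb hl _ ih => rw [List.append_assoc]; exact .block ha hb hl ih

theorem measure_sat {D' : ℕ} (H : SourceWords σ D ss ws) (hD : D ≤ D') :
    ∀ σ', σ <+: σ' → ParSat (ss.map Source.measure) σ' ss.length 1 D' fun vs σ'' =>
      PieceWords σ'' D (List.zipWith Source.toPiece ss vs) ws ∧ vs.flatten.length = ss.length := by
  induction H with
  | nil => exact fun _ _ => .nil ⟨.nil, rfl⟩
  | @lit ss ws w _ ih =>
    intro σ' hσ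
    refine (ParSat.cons (D := D') (Φ := fun v _ => v = [.num w.length]) (.ret rfl)
      (fun σ'' h => ih σ'' (hσ.trans h)) ?_).weaken (W' := (_ :: ss).length) (by simp) le_rfl le_rfl
      fun _ _ _ h => h
    rintro _ vs - σ'' - - rfl ⟨h, h'⟩
    exact ⟨.lit w h, by simp at h' ⊢; omega⟩
  | @block ss ws a blk l r ha hb hl _ ih =>
    intro σ' hσ
    refine (ParSat.cons (D := D') (Φ := fun v _ => v = [.num blk.length])
      (.read (S := 0) (k := fun blk => .ret [.num blk.length]) (getElem?_of_prefix hσ ha) (by omega) (.ret rfl))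
      (fun σ'' h => ih σ'' (hσ.trans h)) ?_).weaken (W' := (_ :: ss).length) (by simp; omega)
      le_rfl le_rfl fun _ _ _ h => h
    rintro _ vs σ₁ σ₂ h₁ h₂ rfl ⟨h, h'⟩
    exact ⟨.slice (getElem?_of_prefix (hσ.trans (h₁.trans h₂)) ha) hb (by omega) h,
      by simp at h' ⊢; omega⟩

theorem concatenate_sat {B D' h lo n : ℕ} {l : List K} (H : SourceWords σ D ss ws)
    (hl : Entries σ B h true false ws l) (hss : ss.length + 1 ≤ D') (hD : D ≤ D')
    (hB : 2 * B + 2 ≤ D') (hn : 2 * n + 1 ≤ D') (hlo : 2 * lo + 1 ≤ ws.length)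
    (hhi : ws.length + 2 * B + 1 < 2 * ((n + 2) * (B + 1))) :
    (concatenate B (h + 1) ss).Sat σ (4 * ss.length + 4 * n + 5) 7 D'
      fun v σ' => ∃ X : Ref, v = X.words ∧ JoinResult σ' B lo (h + 1) n X l := by
  rw [concatenate_eq]
  refine (Prog.Sat.parFor (H.measure_sat hD σ List.prefix_rfl) (by omega)
    (W' := 2 * ss.length + 4 * n + 5) (S' := 5) fun vs σ' hσ hvs => ⟨by omega, ?_⟩).weaken
    (by omega) (by omega) le_rfl fun _ _ _ h => h
  have hlen : (List.zipWith Source.toPiece ss vs).length ≤ ss.length := by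
    rw [List.length_zipWith]; omega
  exact (simpleRebalance_sat hvs.1 (hl.mono hσ) (by omega) hD hB hn hlo hhi).weaken
    (by omega) le_rfl le_rfl fun _ _ _ h => h

end SourceWords

/-! ### Sources for the concatenated root -/

/-- The sources `ss` stand for between `lo` and `hi` words that form a sequence of entries with
in-order list `l`. -/
def SourceEntries (σ : Store K) (B h : ℕ) (ss : List (Source K)) (s e : Bool) (l : List K)
    (lo hi : ℕ) : Prop :=
  ∃ ws, SourceWords σ (2 * B + 1) ss ws ∧ Entries σ B h s e ws l ∧
    lo ≤ ws.length ∧ ws.length ≤ hi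

namespace SourceEntries

variable {σ : Store K} {B h : ℕ} {ss ss' : List (Source K)} {s m e : Bool} {l l' : List K}
  {lo lo' hi hi' : ℕ}

theorem mono {σ' : Store K} (hσ : σ <+: σ') (H : SourceEntries σ B h ss s e l lo hi) :
    SourceEntries σ' B h ss s e l lo hi := by
  obtain ⟨ws, h1, h2, h3⟩ := H
  exact ⟨ws, h1.mono hσ, h2.mono hσ, h3⟩

theorem append (H : SourceEntries σ B h ss s m l lo hi)
    (H' : SourceEntries σ B h ss' m e l' lo' hi') :
    SourceEntries σ B h (ss ++ ss') s e (l ++ l') (lo + lo') (hi + hi') := by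
  obtain ⟨ws, h1, h2, h3, h4⟩ := H
  obtain ⟨ws', g1, g2, g3, g4⟩ := H'
  refine ⟨ws ++ ws', h1.append g1, h2.append g2, ?_⟩
  rw [List.length_append]
  omega

theorem nil (s : Bool) : SourceEntries σ B h [] s s [] 0 0 :=
  ⟨[], .nil, .nil s, le_rfl, le_rfl⟩

theorem key (k : K) : SourceEntries σ B h [.lit [.key k]] false true [k] 1 1 :=
  ⟨[.key k], .lit _ .nil, .key k (.nil _), le_rfl, le_rfl⟩

/-- Either a single pointer, or a whole root of at most `n` keys; `n ≤ B` makes that root fit into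
the block bound. -/
theorem subtree {n : ℕ} {X : Ref} (hn : n ≤ B) (H : JoinResult σ B (B / 2) h n X l) :
    SourceEntries σ B h [subtreeSource (h + 1) X] true false l 1 (2 * n + 1) := by
  rcases H with ⟨hX, H⟩ | ⟨hX, H⟩
  · rw [subtreeSource, if_neg (by omega)]
    have := Entries.tree H (.nil false)
    rw [List.append_nil] at this
    exact ⟨[.ptr X.root], .lit _ .nil, this, le_rfl, by simp⟩
  · obtain ⟨a, ws, ha, hws, g1, g2, g3⟩ := treeAt_succ.1 H
    rw [subtreeSource, if_pos hX, ha]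
    refine ⟨ws, ?_, g1, by omega, by omega⟩
    have := SourceWords.block (D := 2 * B + 1) (l := false) (r := false) hws (by omega)
      (Nat.zero_le _) .nil
    simpa using this

end SourceEntries

theorem Entries.exists_last {σ : Store K} {B h : ℕ} {s : Bool} {ws : List (Word K)} {l : List K}
    (H : Entries σ B h s false ws l) (hws : ws ≠ []) :
    ∃ ws' p l₁ l₂, ws = ws' ++ [.ptr p] ∧ Entries σ B h s true ws' l₁ ∧
      TreeAt σ B (B / 2) B h p l₂ ∧ l = l₁ ++ l₂ := by
  rw [← List.dropLast_append_getLast hws] at H ⊢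
  generalize ws.getLast hws = w at H
  obtain ⟨m, l₁, l₂, h1, h2, rfl⟩ := H.split
  cases h2 with
  | key k h2 => cases h2
  | tree ht h2 =>
    cases h2
    exact ⟨_, _, l₁, _, rfl, h1, ht, by rw [List.append_nil]⟩

theorem TreeAt.split_last {σ : Store K} {B lo h : ℕ} {p : Option ℕ} {l : List K}
    (H : TreeAt σ B lo B (h + 1) p l) :
    ∃ a blk c l₁ l₂, p = some a ∧ σ[a]? = some blk ∧ blk.length ≤ 2 * B + 1 ∧
      blk.getLast? = some (.ptr c) ∧ TreeAt σ B (B / 2) B h c l₂ ∧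
      SourceEntries σ B h [.block p false true] true true l₁ (2 * lo) (2 * B) ∧ l = l₁ ++ l₂ := by
  obtain ⟨a, ws, rfl, ha, h1, h2, h3⟩ := treeAt_succ.1 H
  obtain ⟨ws', c, l₁, l₂, rfl, g1, g2, rfl⟩ := h1.exists_last (by rintro rfl; simp at h2)
  refine ⟨a, _, c, l₁, l₂, rfl, ha, h3, by simp, g2, ?_, rfl⟩
  have := SourceWords.block (D := 2 * B + 1) (l := false) (r := true) ha h3 (Nat.zero_le _) .nil
  rw [List.length_append, List.length_singleton] at h2 h3
  refine ⟨ws', ?_, g1, by omega, by omega⟩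
  simpa using this

/-- With at least one key the leftmost and rightmost subtrees are distinct, so the leading and
trailing calls do not interfere. -/
theorem TreeAt.split_first_last {σ : Store K} {B lo h : ℕ} {p : Option ℕ} {l : List K}
    (H : TreeAt σ B lo B (h + 1) p l) (hlo : 1 ≤ lo) :
    ∃ a blk c c' l₀ l₁ l₂, p = some a ∧ σ[a]? = some blk ∧ blk.length ≤ 2 * B + 1 ∧
      blk.head? = some (.ptr c) ∧ blk.getLast? = some (.ptr c') ∧
      TreeAt σ B (B / 2) B h c l₀ ∧ TreeAt σ B (B / 2) B h c' l₂ ∧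
      SourceEntries σ B h [.block p true true] false true l₁ (2 * lo - 1) (2 * B - 1) ∧
      l = l₀ ++ (l₁ ++ l₂) := by
  obtain ⟨a, ws, rfl, ha, h1, h2, h3⟩ := treeAt_succ.1 H
  cases h1 with
  | @tree _ ws _ c l₀ ht h1 =>
    obtain ⟨ws', c', l₁, l₂, rfl, g1, g2, rfl⟩ := h1.exists_last (by rintro rfl; simp at h2; omega)
    refine ⟨a, _, c, c', l₀, l₁, l₂, rfl, ha, h3, rfl, ?_, ht, g2, ?_, rfl⟩
    · rw [← List.cons_append, List.getLast?_concat]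
    have := SourceWords.block (D := 2 * B + 1) (l := true) (r := true) ha h3 (by simp) .nil
    rw [List.length_cons, List.length_append, List.length_singleton] at h2 h3
    refine ⟨ws', ?_, g1, by omega, by omega⟩
    simpa using this

/-! ### Inputs of the join -/

/-- The reference `t` is a B-tree of height at most `h`; if it is tall, its root has at least
`lo ≥ 1` keys, otherwise `lo = 0`. -/
def IsInput (σ : Store K) (B h : ℕ) (t : Ref) (l : List K) (lo : ℕ) : Prop :=
  t.height = h ∧ 1 ≤ lo ∧ TreeAt σ B lo B h t.root l ∨
    t.height < h ∧ lo = 0 ∧ TreeAt σ B 1 B t.height t.root l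

/-- The list `k₁ T₁ k₂ T₂ …` consists of keys and B-trees of heights between `m` and `h`, with
in-order list `l`, and the roots of the tall trees have at least `lo` keys in total. -/
inductive Inputs (σ : Store K) (B m h : ℕ) : List (K × Ref) → List K → ℕ → Prop
  | nil : Inputs σ B m h [] [] 0
  | cons {t l lo xs l' lo'} (k : K) : m ≤ t.height → IsInput σ B h t l lo →
      Inputs σ B m h xs l' lo' → Inputs σ B m h ((k, t) :: xs) (k :: (l ++ l')) (lo + lo')

/-- Each of the groups consists of a key, a tree of height `h + 1` and a list of inputs of height
at most `h`; the latter have `n` trees in total, and the roots of the former at least `lo` keys. -/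
inductive Groups (σ : Store K) (B m h : ℕ) :
    List (K × Ref × List (K × Ref)) → List K → ℕ → ℕ → Prop
  | nil : Groups σ B m h [] [] 0 0
  | cons {t l lo s l' lo' gs l'' lo'' n} (k : K) : 1 ≤ lo → TreeAt σ B lo B (h + 1) t.root l →
      Inputs σ B m h s l' lo' → Groups σ B m h gs l'' lo'' n →
      Groups σ B m h ((k, t, s) :: gs) (k :: (l ++ l' ++ l'')) (lo + lo'') (s.length + n)

section Inputs

variable {σ σ' : Store K} {B m h : ℕ}

theorem IsInput.mono (hσ : σ <+: σ') {t : Ref} {l : List K} {lo : ℕ}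
    (H : IsInput σ B h t l lo) : IsInput σ' B h t l lo :=
  H.imp (fun H => ⟨H.1, H.2.1, H.2.2.mono hσ⟩) fun H => ⟨H.1, H.2.1, H.2.2.mono hσ⟩

theorem IsInput.height_le {t : Ref} {l : List K} {lo : ℕ} (H : IsInput σ B h t l lo) :
    t.height ≤ h := by
  rcases H with H | H <;> omega

/-- Reclassifies a short tree one level down, where it may become tall; one root key then suffices
for `lo`. -/
theorem isInput_of_height_le {t : Ref} {l : List K} (ht : t.height ≤ h)
    (H : TreeAt σ B 1 B t.height t.root l) : ∃ lo, IsInput σ B h t l lo := by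
  rcases ht.eq_or_lt with rfl | ht
  · exact ⟨1, Or.inl ⟨rfl, le_rfl, H⟩⟩
  · exact ⟨0, Or.inr ⟨ht, rfl, H⟩⟩

theorem Inputs.mono (hσ : σ <+: σ') {xs : List (K × Ref)} {l : List K} {lo : ℕ}
    (H : Inputs σ B m h xs l lo) : Inputs σ' B m h xs l lo := by
  induction H with
  | nil => exact .nil
  | cons k hm ht _ ih => exact .cons k hm (ht.mono hσ) ih

theorem Inputs.append {xs ys : List (K × Ref)} {l l' : List K} {lo lo' : ℕ}
    (H : Inputs σ B m h xs l lo) (H' : Inputs σ B m h ys l' lo') :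
    Inputs σ B m h (xs ++ ys) (l ++ l') (lo + lo') := by
  induction H with
  | nil => simpa using H'
  | cons k hm ht _ ih => simpa [add_assoc] using Inputs.cons k hm ht ih

theorem Groups.mono (hσ : σ <+: σ') {gs : List (K × Ref × List (K × Ref))} {l : List K}
    {lo n : ℕ} (H : Groups σ B m h gs l lo n) : Groups σ' B m h gs l lo n := by
  induction H with
  | nil => exact .nil
  | cons k hlo ht hs _ ih => exact .cons k hlo (ht.mono hσ) (hs.mono hσ) ih

/-- The length identity accounts for every separator exactly once, on which both the size bound and
the work bound rest. -/
theorem splitTall_spec {xs : List (K × Ref)} {l : List K} {lo : ℕ}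
    (H : Inputs σ B m (h + 1) xs l lo) :
    ∃ s gs l₁ l₂ lo₁ n, splitTall (h + 1) xs = (s, gs) ∧ Inputs σ B m h s l₁ lo₁ ∧
      Groups σ B m h gs l₂ lo n ∧ l = l₁ ++ l₂ ∧ xs.length = s.length + gs.length + n := by
  induction H with
  | nil => exact ⟨[], [], [], [], 0, 0, rfl, .nil, .nil, rfl, rfl⟩
  | @cons t l lo xs l' lo' k hm ht _ ih =>
    obtain ⟨s, gs, l₁, l₂, lo₁, n, e, h1, h2, rfl, h3⟩ := ih
    rcases ht with ⟨hh, h4, ht⟩ | ⟨hh, rfl, ht⟩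
    · refine ⟨[], (k, t, s) :: gs, [], _, 0, _, ?_, .nil, .cons k h4 ht h1 h2, by simp, ?_⟩
      · rw [splitTall, e]; simp [hh]
      · simp; omega
    · obtain ⟨lo₂, h4⟩ := isInput_of_height_le (Nat.lt_succ_iff.1 hh) ht
      refine ⟨(k, t) :: s, gs, _, l₂, _, n, ?_, .cons k hm h4 h1, by simpa using h2, by simp, ?_⟩
      · rw [splitTall, e]; simp [hh.ne]
      · simp; omega

theorem Inputs.entries_zero {xs : List (K × Ref)} {l : List K} {lo : ℕ}
    (H : Inputs σ B m 0 xs l lo) :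
    Entries σ B 0 false false (xs.map fun y => [Word.key y.1, .ptr y.2.root]).flatten l := by
  induction H with
  | nil => exact .nil _
  | cons k _ ht _ ih =>
    rcases ht with ⟨_, _, ht⟩ | ⟨h, _⟩
    · exact .key k (.tree (treeAt_zero.2 (treeAt_zero.1 ht)) ih)
    · exact absurd h (Nat.not_lt_zero _)

end Inputs

/-! ### The recursive calls -/

theorem JoinResult.weaken {σ : Store K} {B lo lo' h n : ℕ} {X : Ref} {l : List K}
    (H : JoinResult σ B lo h n X l) (hlo : lo' ≤ lo) : JoinResult σ B lo' h n X l :=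
  H.imp_left fun H => ⟨H.1, H.2.weaken hlo le_rfl⟩

theorem Ref.ofWords_words (X : Ref) : Ref.ofWords (K := K) X.words = X := rfl

/-- Correctness and cost of `joinAt` at height `h` for trees of height at least `m`. -/
def JoinSpec (K : Type u) (B m h : ℕ) : Prop :=
  ∀ (σ : Store K) (t : Ref) (xs : List (K × Ref)) (l l' : List K) (lo lo' : ℕ),
    IsInput σ B h t l lo → (xs ≠ [] → m ≤ t.height) → Inputs σ B m h xs l' lo' → 1 ≤ lo + lo' →
    xs.length ≤ B →
    (joinAt B h t xs).Sat σ (40 * (xs.length * (h + 1 - m))) (40 * (h + 1 - m)) (6 * B)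
      fun v σ' => ∃ X : Ref, v = X.words ∧ JoinResult σ' B (lo + lo') h xs.length X (l ++ l')

/-- The join of the rightmost subtree of the tall tree `t` with the short trees `s`. -/
def trailingCall (B h : ℕ) (t : Ref) (s : List (K × Ref)) : Prog K :=
  .readPtr t.root fun blk => joinAt B h ⟨Word.toPtr blk.getLast?, h⟩ s

/-- The sources for a group with the result `X` of its trailing call. -/
def groupSources (h : ℕ) (g : K × Ref × List (K × Ref)) (X : Ref) : List (Source K) :=
  [.lit [.key g.1], .block g.2.1.root false true, subtreeSource h X]

section Calls

variable {σ : Store K} {B m h : ℕ}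

theorem trailingCall_sat (hB : 2 ≤ B) (hJ : JoinSpec K B m h) {t : Ref} {s : List (K × Ref)}
    {a lo : ℕ} {blk : List (Word K)} {c : Option ℕ} {l l' : List K} (ht : t.root = some a)
    (ha : σ[a]? = some blk) (hblk : blk.length ≤ 2 * B + 1) (hc : blk.getLast? = some (.ptr c))
    (hl : TreeAt σ B (B / 2) B h c l) (hs : Inputs σ B m h s l' lo) (hsB : s.length ≤ B) :
    (trailingCall B h t s).Sat σ (1 + 40 * (s.length * (h + 1 - m))) (1 + 40 * (h + 1 - m)) (6 * B)
      fun v σ' => ∃ X : Ref, v = X.words ∧ JoinResult σ' B (B / 2) h s.length X (l ++ l') := by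
  rw [trailingCall, ht]
  refine .read ha (by omega) ?_
  rw [hc]
  refine (hJ σ ⟨c, h⟩ s l l' (B / 2) lo (Or.inl ⟨rfl, by omega, hl⟩) (fun hne => ?_) hs (by omega)
    hsB).weaken le_rfl le_rfl le_rfl ?_
  -- The subtree may be lower than `m`, but only if there are no short trees; otherwise one of them
  -- has height between `m` and `h`.
  · cases hs with
    | nil => exact absurd rfl hne
    | cons k hm ht _ => exact hm.trans ht.height_le
  · rintro v σ' - ⟨X, rfl, hX⟩
    exact ⟨X, rfl, hX.weaken (by omega)⟩

/-- The subtree of the tall tree is appended as last input, so the key `k` in front of that tree is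
one more separator. Its at least `B / 2 ≥ 1` root keys also provide the required tall input. -/
theorem leadingCall_sat (hB : 2 ≤ B) (hJ : JoinSpec K B m h) {u t : Ref} {s : List (K × Ref)}
    {a lo : ℕ} {blk : List (Word K)} {c : Option ℕ} {l₀ l l' : List K} {lo₀ : ℕ} (k : K)
    (ht : t.root = some a)
    (ha : σ[a]? = some blk) (hblk : blk.length ≤ 2 * B + 1) (hc : blk.head? = some (.ptr c))
    (hl : TreeAt σ B (B / 2) B h c l) (hu : IsInput σ B h u l₀ lo₀) (hm : m ≤ u.height)
    (hs : Inputs σ B m h s l' lo) (hsB : s.length + 1 ≤ B) :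
    (Prog.readPtr t.root fun blk =>
        joinAt B h u (s ++ [(k, ⟨Word.toPtr blk.head?, h⟩)])).Sat σ
      (1 + 40 * ((s.length + 1) * (h + 1 - m))) (1 + 40 * (h + 1 - m)) (6 * B)
      fun v σ' => ∃ X : Ref, v = X.words ∧
        JoinResult σ' B (B / 2) h (s.length + 1) X (l₀ ++ l' ++ k :: l) := by
  rw [ht]
  refine .read ha (by omega) ?_
  rw [hc]
  have := hJ σ u _ l₀ _ lo₀ _ hu (fun _ => hm) (hs.append (.cons (t := ⟨c, h⟩) k
    (hm.trans hu.height_le) (Or.inl ⟨rfl, by omega, hl⟩) .nil)) (by omega) (by simpa using hsB)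
  refine this.weaken (by simp) le_rfl le_rfl ?_
  rintro v σ' - ⟨X, rfl, hX⟩
  refine ⟨X, rfl, ?_⟩
  have := hX.weaken (lo' := B / 2) (by omega)
  simpa using this

/-- Per group at most `2 * B + 2` words besides the moved-up keys: separator, truncated root and one
pointer. Moved-up keys add two words per separator of the call. -/
theorem groups_sat (hB : 2 ≤ B) (hJ : JoinSpec K B m h) {gs : List (K × Ref × List (K × Ref))}
    {l : List K} {lo n : ℕ} (H : Groups σ B m h gs l lo n) (hn : n ≤ B) :
    ∀ σ', σ <+: σ' → ParSat (gs.map fun g => trailingCall B h g.2.1 g.2.2) σ'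
      (gs.length + 40 * (n * (h + 1 - m))) (1 + 40 * (h + 1 - m)) (6 * B) fun vs σ'' =>
        SourceEntries σ'' B h
          (List.zipWith (groupSources (h + 1)) gs (vs.map Ref.ofWords)).flatten false false l
          (2 * lo + 2 * gs.length) (gs.length * (2 * B + 2) + 2 * n) ∧
        (List.zipWith (groupSources (h + 1)) gs (vs.map Ref.ofWords)).flatten.length =
          3 * gs.length ∧
        vs.flatten.length = 2 * gs.length := by
  induction H with
  | nil =>
    intro σ' _
    refine ParSat.weaken (W := 0) (ParSat.nil ?_) (Nat.zero_le _) le_rfl le_rfl fun _ _ _ h => h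
    simpa using SourceEntries.nil false
  | @cons t l lo s l' lo' gs l'' lo'' n k _ ht hs _ ih =>
    intro σ' hσ
    obtain ⟨a, blk, c, l₁, l₂, h1, h2, h3, h4, h5, h6, rfl⟩ := (ht.mono hσ).split_last
    rw [List.map_cons]
    refine (ParSat.cons (trailingCall_sat hB hJ h1 h2 h3 h4 h5 (hs.mono hσ) (by omega))
      (fun σ'' hσ' => ih (by omega) σ'' (hσ.trans hσ')) ?_).weaken
      (W' := ((k, t, s) :: gs).length + 40 * ((s.length + n) * (h + 1 - m)))
      (by rw [List.length_cons, add_mul]; omega) le_rfl le_rfl fun _ _ _ h => h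
    rintro v vs σ₁ σ₂ g₁ g₂ ⟨X, rfl, hX⟩ ⟨g3, g4, g5⟩
    refine ⟨?_, ?_, ?_⟩
    · have := ((SourceEntries.key k).append ((h6.mono (g₁.trans g₂)).append
        (SourceEntries.subtree (by omega) (hX.mono g₂)))).append g3
      obtain ⟨ws, e1, e2, e3, e4⟩ := this
      refine ⟨ws, e1, by simpa using e2, ?_, ?_⟩
      · rw [List.length_cons]; omega
      · rw [List.length_cons, add_mul]; omega
    · simp only [List.map_cons, List.zipWith_cons_cons, List.flatten_cons, List.length_append, g4,
        List.length_cons]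
      simp [groupSources]; omega
    · simp only [List.flatten_cons, List.length_append, g5, List.length_cons]
      simp [Ref.words]; omega

end Calls

/-! ### The join -/

theorem joinAt_nil (B h : ℕ) (t : Ref) : joinAt B h t ([] : List (K × Ref)) = .ret t.words := by
  cases h <;> rfl

theorem joinAt_of_lead_eq_none {B h : ℕ} {t₀ t : Ref} {xs s : List (K × Ref)}
    {gs : List (K × Ref × List (K × Ref))} (hxs : xs ≠ [])
    (hG : grouping (h + 1) t₀ xs = ⟨none, t, s, gs⟩) :
    joinAt B (h + 1) t₀ xs = .parFor
      (trailingCall B h t s :: gs.map fun g => trailingCall B h g.2.1 g.2.2) id fun replies =>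
        concatenate B (h + 1) <|
          [.block t.root false true,
            subtreeSource (h + 1) ((replies.map Ref.ofWords).headD ⟨none, 0⟩)] ++
          (List.zipWith (groupSources (h + 1)) gs (replies.map Ref.ofWords).tail).flatten := by
  obtain ⟨x, xs, rfl⟩ := List.exists_cons_of_ne_nil hxs
  rw [joinAt, hG]
  dsimp only
  rw [List.map_cons, List.map_map]
  rfl

theorem joinAt_of_lead_eq_some {B h : ℕ} {t₀ u t : Ref} {xs s₀ s : List (K × Ref)} {k : K}
    {gs : List (K × Ref × List (K × Ref))} (hxs : xs ≠ [])
    (hG : grouping (h + 1) t₀ xs = ⟨some (u, s₀, k), t, s, gs⟩) :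
    joinAt B (h + 1) t₀ xs = .parFor
      ((.readPtr t.root fun blk => joinAt B h u (s₀ ++ [(k, ⟨Word.toPtr blk.head?, h⟩)])) ::
        trailingCall B h t s :: gs.map fun g => trailingCall B h g.2.1 g.2.2) id fun replies =>
        concatenate B (h + 1) <|
          [subtreeSource (h + 1) (Ref.ofWords (replies.headD [])), .block t.root true true,
            subtreeSource (h + 1) ((replies.tail.map Ref.ofWords).headD ⟨none, 0⟩)] ++
          (List.zipWith (groupSources (h + 1)) gs (replies.tail.map Ref.ofWords).tail).flatten := by
  obtain ⟨x, xs, rfl⟩ := List.exists_cons_of_ne_nil hxs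
  rw [joinAt, hG]
  dsimp only
  rw [List.map_cons, List.map_map]
  rfl

/-- The words of a concatenated root whose `g + 1` tall trees and `n` short trees have been
joined form at most `g + n + 1` nodes. -/
theorem concatenated_length_lt {B g n len : ℕ}
    (hlen : len ≤ 2 * B + 2 * n + 1 + g * (2 * B + 2)) :
    len + 2 * B + 1 < 2 * ((g + n + 2) * (B + 1)) := by
  have h1 : (g + n + 2) * (B + 1) = g * (B + 1) + n * B + n + 2 * (B + 1) := by ring
  have h2 : g * (2 * B + 2) = 2 * (g * (B + 1)) := by ring
  omega

/-- The recursion for the work, with `c` and `n` the numbers of separator keys of a call and of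
its recursive calls. -/
theorem work_recursion {x c n h m : ℕ} (hx : x ≤ 40 * c) (hn : n ≤ c) (hm : m ≤ h + 1) :
    x + 40 * (n * (h + 1 - m)) ≤ 40 * (c * (h + 1 + 1 - m)) := by
  have h1 : h + 1 + 1 - m = (h + 1 - m) + 1 := by omega
  have h2 := Nat.mul_le_mul_right (h + 1 - m) hn
  rw [h1, mul_add]
  omega

/-- Induction on the height. The constant 40 leaves slack over the cost of one level: 9 units of
span and at most 33 units of work per separator. -/
theorem joinSpec (K : Type u) {B : ℕ} (hB : 2 ≤ B) (m h : ℕ) : JoinSpec K B m h := by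
  induction h with
  | zero =>
    intro σ t xs l l' lo lo' ht hm hxs hlo hB'
    by_cases hne : xs = []
    · subst hne
      cases hxs
      rcases ht with ⟨h1, -, h2⟩ | ⟨h1, -⟩
      · rw [joinAt_nil]
        exact (Prog.Sat.ret ⟨t, rfl, Or.inl ⟨h1, by simpa using h2⟩⟩).weaken (Nat.zero_le _) le_rfl
          le_rfl fun _ _ _ h => h
      · exact absurd h1 (Nat.not_lt_zero _)
    · have hm0 : m = 0 := by have := ht.height_le; have := hm hne; omega
      obtain ⟨x, xs', rfl⟩ := List.exists_cons_of_ne_nil hne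
      rw [joinAt]
      have ht' : TreeAt σ B (B / 2) B 0 t.root l := by
        rcases ht with ⟨_, _, ht⟩ | ⟨h, _⟩
        · exact treeAt_zero.2 (treeAt_zero.1 ht)
        · exact absurd h (Nat.not_lt_zero _)
      have hH := Entries.tree ht' hxs.entries_zero
      have hlen : (Word.ptr t.root :: ((x :: xs').map fun y =>
          [Word.key y.1, .ptr y.2.root]).flatten).length = 2 * (x :: xs').length + 1 := by
        rw [List.length_cons, List.length_flatten, List.map_map]
        simp [Function.comp_def]
        omega
      subst hm0
      have h1 : 1 ≤ (x :: xs').length := by simp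
      -- The new root, one level up, has exactly the separators as keys: the second alternative of
      -- `JoinResult`, with equality.
      refine (Prog.Sat.alloc (W := 0) (S := 0) (by omega) fun a σ' hσ ha => .ret
        ⟨⟨some a, 1⟩, rfl, Or.inr ⟨rfl, treeAt_succ.2 ⟨a, _, rfl, ha, hH.mono hσ, by omega,
          by omega⟩⟩⟩).weaken (by omega) (by omega) le_rfl fun _ _ _ h => h
  | succ h ih =>
    intro σ t xs l l' lo lo' ht hm hxs hlo hB'
    by_cases hne : xs = []
    · subst hne
      cases hxs
      rcases ht with ⟨h1, -, h2⟩ | ⟨-, rfl, -⟩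
      · rw [joinAt_nil]
        exact (Prog.Sat.ret ⟨t, rfl, Or.inl ⟨h1, by simpa using h2⟩⟩).weaken (Nat.zero_le _)
          (Nat.zero_le _) le_rfl fun _ _ _ h => h
      · omega
    have hmh : m ≤ h + 1 := (hm hne).trans ht.height_le
    have hpos : 1 ≤ xs.length := List.length_pos_iff.2 hne
    obtain ⟨s, gs, l₁, l₂, lo₁, n, hsplit, hs, hgs, rfl, hlen⟩ := splitTall_spec hxs
    rcases ht with ⟨hth, hlo1, ht⟩ | ⟨hth, rfl, ht⟩
    · rw [joinAt_of_lead_eq_none (t := t) (s := s) (gs := gs) hne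
        (by rw [grouping, hsplit]; simp [hth])]
      obtain ⟨a, blk, c, m₁, m₂, h1, h2, h3, h4, h5, h6, rfl⟩ := ht.split_last
      refine (Prog.Sat.parFor
        (W := 1 + 40 * (s.length * (h + 1 - m)) + (gs.length + 40 * (n * (h + 1 - m))))
        (S := 1 + 40 * (h + 1 - m)) (W' := 4 * (3 * gs.length + 2) + 4 * xs.length + 5) (S' := 7)
        (Ψ := fun vs σ' => ∃ (X : Ref) (vs' : List (List (Word K))), vs = X.words :: vs' ∧
          JoinResult σ' B (B / 2) h s.length X (m₂ ++ l₁) ∧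
          SourceEntries σ' B h
            (List.zipWith (groupSources (h + 1)) gs (vs'.map Ref.ofWords)).flatten false false l₂
            (2 * lo' + 2 * gs.length) (gs.length * (2 * B + 2) + 2 * n) ∧
          (List.zipWith (groupSources (h + 1)) gs (vs'.map Ref.ofWords)).flatten.length =
            3 * gs.length ∧
          vs'.flatten.length = 2 * gs.length)
        ?_ ?_ ?_).weaken ?_ ?_ le_rfl fun _ _ _ h => h
      · rw [List.map_id]
        refine ParSat.cons (trailingCall_sat hB ih h1 h2 h3 h4 h5 hs (by omega))
          (groups_sat hB ih hgs (by omega)) ?_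
        rintro v vs σ₁ σ₂ - g₂ ⟨X, rfl, hX⟩ hvs
        exact ⟨X, vs, rfl, hX.mono g₂, hvs⟩
      · simp; omega
      · rintro _ σ' hσ ⟨X, vs, rfl, hX, g1, g2, g3⟩
        refine ⟨by simp [Ref.words] at g3 ⊢; omega, ?_⟩
        simp only [List.map_cons, List.headD_cons, List.tail_cons, Ref.ofWords_words]
        obtain ⟨ws, e1, e2, e3, e4⟩ :=
          ((h6.mono hσ).append (SourceEntries.subtree (by omega) hX)).append g1
        have hss : ([Source.block t.root false true, subtreeSource (h + 1) X] ++
            (List.zipWith (groupSources (h + 1)) gs (vs.map Ref.ofWords)).flatten).length =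
            3 * gs.length + 2 := by
          rw [List.length_append, g2]; simp; omega
        have hhi := concatenated_length_lt (B := B) (g := gs.length) (n := s.length + n)
          (len := ws.length) (by omega)
        refine (e1.concatenate_sat (D' := 6 * B) (lo := lo + lo') (n := xs.length) (h := h) e2 ?_
          (by omega) (by omega) (by omega) (by omega) ?_).weaken ?_ le_rfl le_rfl ?_
        · exact hss ▸ (by omega)
        · rwa [hlen, show s.length + gs.length + n = gs.length + (s.length + n) by omega]
        · exact hss ▸ le_rfl
        · rintro v σ'' - ⟨X, rfl, hX⟩
          exact ⟨X, rfl, by simpa using hX⟩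
      -- `x` is the local work: `gs.length + 1` threads, as many root reads, and the concatenation.
      · have := work_recursion (x := 2 + 2 * gs.length + (4 * (3 * gs.length + 2) +
          4 * xs.length + 5)) (c := xs.length) (n := s.length + n) (by omega) (by omega) hmh
        rw [add_mul] at this
        simp; omega
      · omega
    · cases hgs with
      -- If the first tree is short, `1 ≤ lo + lo'` forces a tall tree among the others.
      | nil => omega
      | @cons t' lt lo₂ s' l₃ lo₃ gs l₄ lo₄ n k hlo₂ ht' hs' hgs =>
      rw [joinAt_of_lead_eq_some (u := t) (s₀ := s) (k := k) (t := t') (s := s') (gs := gs) hne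
        (by rw [grouping, hsplit]; simp [hth.ne])]
      rw [List.length_cons] at hlen
      obtain ⟨a, blk, c, c', m₀, m₁, m₂, h1, h2, h3, h4, h5, h6, h7, h8, rfl⟩ :=
        ht'.split_first_last hlo₂
      obtain ⟨lo₀, hu⟩ := isInput_of_height_le (Nat.lt_succ_iff.1 hth) ht
      refine (Prog.Sat.parFor
        (W := 1 + 40 * ((s.length + 1) * (h + 1 - m)) + (1 + 40 * (s'.length * (h + 1 - m)) +
          (gs.length + 40 * (n * (h + 1 - m)))))
        (S := 1 + 40 * (h + 1 - m)) (W' := 4 * (3 * gs.length + 3) + 4 * xs.length + 5) (S' := 7)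
        (Ψ := fun vs σ' => ∃ (Y X : Ref) (vs' : List (List (Word K))),
          vs = Y.words :: X.words :: vs' ∧
          JoinResult σ' B (B / 2) h (s.length + 1) Y (l ++ l₁ ++ k :: m₀) ∧
          JoinResult σ' B (B / 2) h s'.length X (m₂ ++ l₃) ∧
          SourceEntries σ' B h
            (List.zipWith (groupSources (h + 1)) gs (vs'.map Ref.ofWords)).flatten false false l₄
            (2 * lo₄ + 2 * gs.length) (gs.length * (2 * B + 2) + 2 * n) ∧
          (List.zipWith (groupSources (h + 1)) gs (vs'.map Ref.ofWords)).flatten.length =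
            3 * gs.length ∧
          vs'.flatten.length = 2 * gs.length)
        ?_ ?_ ?_).weaken ?_ ?_ le_rfl fun _ _ _ h => h
      · rw [List.map_id]
        refine ParSat.cons (leadingCall_sat hB ih k h1 h2 h3 h4 h6 hu (hm hne) hs (by omega))
          (Ψ := fun vs σ' => ∃ (X : Ref) (vs' : List (List (Word K))), vs = X.words :: vs' ∧
            JoinResult σ' B (B / 2) h s'.length X (m₂ ++ l₃) ∧
            SourceEntries σ' B h
              (List.zipWith (groupSources (h + 1)) gs (vs'.map Ref.ofWords)).flatten false false l₄
              (2 * lo₄ + 2 * gs.length) (gs.length * (2 * B + 2) + 2 * n) ∧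
            (List.zipWith (groupSources (h + 1)) gs (vs'.map Ref.ofWords)).flatten.length =
              3 * gs.length ∧
            vs'.flatten.length = 2 * gs.length)
          (fun σ' hσ => ?_) ?_
        · refine ParSat.cons (trailingCall_sat hB ih h1 (getElem?_of_prefix hσ h2) h3 h5
            (h7.mono hσ) (hs'.mono hσ) (by omega))
            (groups_sat hB ih (hgs.mono hσ) (by omega)) ?_
          rintro v vs σ₁ σ₂ - g₂ ⟨X, rfl, hX⟩ hvs
          exact ⟨X, vs, rfl, hX.mono g₂, hvs⟩
        · rintro v _ σ₁ σ₂ - g₂ ⟨Y, rfl, hY⟩ ⟨X, vs, rfl, hX⟩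
          exact ⟨Y, X, vs, rfl, hY.mono g₂, hX⟩
      · simp; omega
      · rintro _ σ' hσ ⟨Y, X, vs, rfl, hY, hX, g1, g2, g3⟩
        refine ⟨by simp [Ref.words] at g3 ⊢; omega, ?_⟩
        simp only [List.map_cons, List.headD_cons, List.tail_cons, Ref.ofWords_words]
        obtain ⟨ws, e1, e2, e3, e4⟩ := ((SourceEntries.subtree (by omega) hY).append
          ((h8.mono hσ).append (SourceEntries.subtree (by omega) hX))).append g1
        have hss : ([subtreeSource (h + 1) Y, Source.block t'.root true true,
            subtreeSource (h + 1) X] ++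
            (List.zipWith (groupSources (h + 1)) gs (vs.map Ref.ofWords)).flatten).length =
            3 * gs.length + 3 := by
          rw [List.length_append, g2]; simp; omega
        have hhi := concatenated_length_lt (B := B) (g := gs.length)
          (n := s.length + 1 + s'.length + n) (len := ws.length) (by omega)
        refine (e1.concatenate_sat (D' := 6 * B) (lo := lo₂ + lo₄) (n := xs.length) (h := h) e2 ?_
          (by omega) (by omega) (by omega) (by omega) ?_).weaken ?_ le_rfl le_rfl ?_
        · exact hss ▸ (by omega)
        · rwa [show xs.length = gs.length + (s.length + 1 + s'.length + n) by omega]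
        · exact hss ▸ le_rfl
        · rintro v σ'' - ⟨X, rfl, hX⟩
          exact ⟨X, rfl, by simpa using hX⟩
      · have := work_recursion (x := 4 + 2 * gs.length + (4 * (3 * gs.length + 3) +
          4 * xs.length + 5)) (c := xs.length) (n := s.length + 1 + s'.length + n)
          (by omega) (by omega) hmh
        rw [add_mul, add_mul] at this
        simp; omega
      · omega

/-! ### Translation between trees and join inputs, and the theorem -/

theorem inputs_ofFn {σ : Store K} {B m h b : ℕ} (k : Fin b → K) (t : Fin b → Ref)
    (L : Fin b → List K) (hm : ∀ i, m ≤ (t i).height) (hh : ∀ i, (t i).height ≤ h)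
    (H : ∀ i, TreeAt σ B 1 B (t i).height (t i).root (L i)) :
    ∃ lo, Inputs σ B m h (List.ofFn fun i => (k i, t i))
      (List.ofFn fun i => k i :: L i).flatten lo ∧ ((∃ i, (t i).height = h) → 1 ≤ lo) := by
  induction b with
  | zero => exact ⟨0, .nil, fun ⟨i, _⟩ => i.elim0⟩
  | succ b ih =>
    obtain ⟨lo, h1, h2⟩ := ih (fun i => k i.succ) (fun i => t i.succ) (fun i => L i.succ)
      (fun i => hm i.succ) (fun i => hh i.succ) fun i => H i.succ
    obtain ⟨lo₀, h0⟩ := isInput_of_height_le (hh 0) (H 0)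
    simp only [List.ofFn_succ, List.flatten_cons]
    refine ⟨lo₀ + lo, .cons _ (hm 0) h0 h1, ?_⟩
    rintro ⟨i, hi⟩
    induction i using Fin.cases with
    | zero => rcases h0 with h0 | h0 <;> omega
    | succ i => have := h2 ⟨i, hi⟩; omega

theorem isBTree_of_treeAt [LinearOrder K] {σ : Store K} {B lo hi h : ℕ} {p : Option ℕ}
    {l : List K} (H : TreeAt σ B lo hi h p l) (hlo : 1 ≤ lo) (hhi : hi ≤ B)
    (hl : l.Pairwise (· < ·)) :
    ∃ T : BTree K, T.Stored σ p ∧ T.IsBTree B ∧ T.height = h ∧ T.keys = {x | x ∈ l} := by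
  obtain ⟨T, h1, h2, h3, rfl⟩ := H.weaken hlo hhi
  exact ⟨T, h1, (BTree.withRoot_iff B T 1).2 ⟨h2, hl⟩, h3, Set.ext fun x => (T.mem_inorder x).symm⟩

end BWay

theorem mainTheorem5 :
    ∃ C : ℕ, ∀ (K : Type*) [LinearOrder K] (B : ℕ), 2 ≤ B →
      ∀ (b : ℕ), b ≤ B →
      ∀ (T : Fin (b + 1) → BWay.BTree K) (k : Fin b → K),
        (∀ i, (T i).IsBTree B) →
        BWay.BTree.SearchOrder k (fun i => (T i).keys) →
      ∀ (hmax hmin : ℕ),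
        IsGreatest (Set.range fun i => (T i).height) hmax →
        IsLeast (Set.range fun i => (T i).height) hmin →
      ∀ (σ : BWay.Store K) (root : Fin (b + 1) → Option ℕ),
        (∀ i, (T i).Stored σ (root i)) →
      ∀ (r : BWay.Outcome K (List (BWay.Word K))),
        r = (BWay.bWayJoin B (fun i => ⟨root i, (T i).height⟩) k).run σ →
        (∃ (T' : BWay.BTree K) (root' : Option ℕ),
          r.val = BWay.Ref.words ⟨root', T'.height⟩ ∧
          T'.Stored r.store root' ∧
          T'.IsBTree B ∧
          T'.keys = Set.range k ∪ ⋃ i, (T i).keys) ∧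
        r.span ≤ C * (hmax - hmin + 1) ∧
        r.work ≤ C * (b * (hmax - hmin + 1)) ∧
        r.width ≤ C * B := by
  refine ⟨40, fun K _ B hB b hbB T k hT hk hmax hmin hgt hlt σ root hroot r hr => ?_⟩
  have hh : ∀ i, (T i).height ≤ hmax := fun i => hgt.2 ⟨i, rfl⟩
  have hm : ∀ i, hmin ≤ (T i).height := fun i => hlt.2 ⟨i, rfl⟩
  obtain ⟨i₀, hi₀⟩ := hgt.1
  dsimp only at hi₀
  have hsup : (Finset.univ.sup fun i => (T i).height) = hmax :=
    le_antisymm (Finset.sup_le fun i _ => hh i)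
      (hi₀ ▸ Finset.le_sup (f := fun i => (T i).height) (Finset.mem_univ i₀))
  have hTA : ∀ i, BWay.TreeAt σ B 1 B (T i).height (root i) (T i).inorder := fun i =>
    ⟨T i, hroot i, ((BWay.BTree.withRoot_iff B (T i) 1).1 (hT i)).1, rfl, rfl⟩
  obtain ⟨lo, hI, hlo⟩ := BWay.inputs_ofFn (σ := σ) (B := B) (m := hmin) (h := hmax) k
    (fun i => ⟨root i.succ, (T i.succ).height⟩) (fun i => (T i.succ).inorder)
    (fun i => hm i.succ) (fun i => hh i.succ) fun i => hTA i.succ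
  obtain ⟨lo₀, h0⟩ := BWay.isInput_of_height_le (t := ⟨root 0, (T 0).height⟩) (hh 0) (hTA 0)
  have hpos : 1 ≤ lo₀ + lo := by
    -- A tree of maximal height is either the first one or in the list; it makes the total weight
    -- positive.
    induction i₀ using Fin.cases with
    | zero =>
      rcases h0 with h0 | h0
      · omega
      · exact absurd hi₀ h0.1.ne
    | succ i => have := hlo ⟨i, hi₀⟩; omega
  have key := BWay.joinSpec K hB hmin hmax σ _ _ _ _ _ _ h0 (fun _ => hm 0) hI hpos
    (by simpa using hbB)
  rw [BWay.bWayJoin, hsup] at hr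
  rw [BWay.Prog.Sat, ← hr] at key
  obtain ⟨-, hwork, hspan, hwidth, X, hX, hJ⟩ := key
  have hle : hmax + 1 - hmin = hmax - hmin + 1 := by have := hh 0; have := hm 0; omega
  rw [hle] at hwork hspan
  rw [List.length_ofFn] at hwork hJ
  refine ⟨?_, hspan, hwork, by omega⟩
  have hsorted := (BWay.BTree.pairwise_interleave_iff k fun i => (T i).inorder).2
    ⟨fun i => ((BWay.BTree.withRoot_iff B (T i) 1).1 (hT i)).2, by
      rwa [show (fun i => {x | x ∈ (T i).inorder}) = fun i => (T i).keys from
        funext fun i => Set.ext fun x => (T i).mem_inorder x]⟩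
  obtain ⟨T', h1, h2, h3, h4⟩ : ∃ T' : BWay.BTree K, T'.Stored r.store X.root ∧ T'.IsBTree B ∧
      T'.height = X.height ∧ T'.keys = {x | x ∈ (T 0).inorder ++
        (List.ofFn fun i => k i :: (T i.succ).inorder).flatten} := by
    -- Both alternatives give a valid root: at least `lo₀ + lo ≥ 1` keys at height `hmax`, or
    -- between `1` and `b ≤ B` keys one level up.
    rcases hJ with ⟨e, hJ⟩ | ⟨e, hJ⟩
    · rw [e]; exact BWay.isBTree_of_treeAt hJ hpos le_rfl hsorted
    · rw [e]; exact BWay.isBTree_of_treeAt hJ le_rfl hbB hsorted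
  refine ⟨T', X.root, by rw [h3, hX], h1, h2, ?_⟩
  rw [h4]
  ext x
  rw [Set.mem_ofPred_eq, BWay.BTree.mem_interleave k fun i => (T i).inorder]
  simp only [BWay.BTree.mem_inorder]
  rfl
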